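/- **Setting.** Let $\mathbf{X}\in\mathbb{R}^{n\times d}$ be a data matrix with rows $\mathbf{x}_i$, let $y_1,\dots,y_n\in\mathbb{R}$ be labels, let $\ell(u;y)$ be a loss that is differentiable in $u$ for the occurring labels, and let $f(\mathbf{w})=\frac1n\sum_{i=1}^n\ell(\langle\mathbf{x}_i,\mathbf{w}\rangle;y_i)$; write $f'(\mathbf{w})\in\mathbb{R}^n$ for the vector with entries $\frac{\partial \ell}{\partial u}(\langle\mathbf{x}_i,\mathbf{w}\rangle;y_i)$, so that $\nabla f(\mathbf{w})=\frac1n\mathbf{X}^Tf'(\mathbf{w})$. There are a master, which stores the labels, and $m\ge1$ workers. In each communication round at most $t$ workers are corrupt (they may collude and send anything) and at most $s$ workers are stragglers (their replies are erased); the master knows $s$ and $t$ but not the corrupt set. Programs are loop-free programs over real registers whose instructions are $+,-,\times,\div$, copying, loading the constant $1$ and comparing two reals; for the master, evaluating $\frac{\partial \ell}{\partial u}(u;y)$ is one more instruction. Time is the number of instructions. The programs depend on $m,n,d,s,t,\epsilon$ only, not on the data. **Theorem (Gradient Computation).** There is an absolute constant $C>0$ such that the following holds for all $m\ge 1$, $n,d\ge0$,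 all real $\epsilon>0$ and all $s,t\ge0$ with $s+t\le\left\lfloor\frac{\epsilon}{1+\epsilon}\cdot\frac m2\right\rfloor$. Put $k=2(s+t)$, $q=m-k$, $p_1=\lceil n/q\rceil$ and $p_2=\lceil d/q\rceil$. There are programs for encoding, for the workers and for the master that form a two-round scheme with the following properties. * **Encoding.** For any distinct non-zero reals $z_1,\dots,z_m$ (which are given to the encoder and to the master) let $\mathbf{F}=(z_i^{a})_{0\le a<k,\,1\le i\le m}$ be the $k\times m$ Vandermonde error-locator matrix, and let $\mathbf{F}^{\perp}\in\mathbb{R}^{m\times q}$ be the matrix whose columns are the basis of the null space of $\mathbf{F}$ for which the last $q$ rows of $\mathbf{F}^\perp$ form the identity matrix. Let $\mathbf{S}_i^{(1)}\in\mathbb{R}^{p_1\times n}$ and $\mathbf{S}_i^{(2)}\in\mathbb{R}^{p_2\times d}$ be the block-diagonal matrices in which the $i$-th row of $\mathbf{F}^\perp$ is repeated along the diagonal (cut off at the last column), all other entries being zero. Worker $i$ stores $\mathbf{S}_i^{(1)}\mathbf{X}$ and $\mathbf{S}_i^{(2)}\mathbf{X}^T$. * **Exactness.** For every $\mathbf{w}\in\mathbb{R}^d$: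 in round 1 the master broadcasts $\mathbf{w}$, honest workers reply with $\mathbf{S}_i^{(1)}\mathbf{X}\mathbf{w}$, and the master computes $f'(\mathbf{w})$ from the labels and the replies received; in round 2 it broadcasts $f'(\mathbf{w})$, honest workers reply with $\mathbf{S}_i^{(2)}\mathbf{X}^Tf'(\mathbf{w})$, and the master outputs exactly $\nabla f(\mathbf{w})$. This holds whatever the at most $t$ corrupt workers and at most $s$ stragglers of each round do. * **Storage.** The total storage (all encoded matrices and the $n$ labels) is at most $2(1+\epsilon)nd+m(n+d)+n$ real numbers, and at most $2(1+\epsilon)nd+n$ if $q$ divides $n$ and $d$; that is, roughly $2(1+\epsilon)|\mathbf{X}|$. * **Communication** for each gradient computation. Each worker sends $p_1+p_2\le\lceil(1+\epsilon)\frac nm\rceil+\lceil(1+\epsilon)\frac dm\rceil$ real numbers, which is at most $(1+\epsilon)\frac{n+d}{m}$ if $q$ divides $n$ and $d$. The master broadcasts $n+d$ real numbers. * **Time**, if $m\le n$ and $m\le d$. Each gradient computation takes time at most $C(1+\epsilon)\frac{nd}{m}$ at each worker and at most $C(1+\epsilon)(n+d)m$ at the master. The total encoding time (done once, and including the computation of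 the encoding matrices from the $z_i$) is at most $C\,nd\left(\frac{\epsilon}{1+\epsilon}m+1\right)$. -/

import Mathlib

open scoped Matrix

noncomputable section

/-! ### A unit-cost model of computation over the reals -/

/-- The four basic arithmetic operations on real numbers. -/
inductive ArithOp
  | add
  | sub
  | mul
  | div

/-- The real function computed by an arithmetic operation. -/
def ArithOp.apply : ArithOp → ℝ → ℝ → ℝ
  | .add, x, y => x + y
  | .sub, x, y => x - y
  | .mul, x, y => x * y
  | .div, x, y => x / y

/-- Loop-free programs over real registers named by `R`. The only constant is `1`; `P` is a set of
names of additional binary primitives on reals. -/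
inductive Code (P R : Type)
  | skip
  | one (dst : R)
  | copy (dst a : R)
  | arith (o : ArithOp) (dst a b : R)
  | prim (f : P) (dst a b : R)
  | ifLe (a b : R) (c₁ c₂ : Code P R)
  | seq (c₁ c₂ : Code P R)

open Classical in
/-- The final register contents, from initial contents `ρ` and an interpretation `φ` of the
primitives. -/
def Code.run {P R : Type} (φ : P → ℝ → ℝ → ℝ) : Code P R → (R → ℝ) → (R → ℝ)
  | .skip, ρ => ρ
  | .one dst, ρ => Function.update ρ dst 1
  | .copy dst a, ρ => Function.update ρ dst (ρ a)
  | .arith o dst a b, ρ => Function.update ρ dst (o.apply (ρ a) (ρ b))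
  | .prim f dst a b, ρ => Function.update ρ dst (φ f (ρ a) (ρ b))
  | .ifLe a b c₁ c₂, ρ => if ρ a ≤ ρ b then c₁.run φ ρ else c₂.run φ ρ
  | .seq c₁ c₂, ρ => c₂.run φ (c₁.run φ ρ)

/-- The number of instructions, both branches of a conditional included. As there are no loops,
every instruction is executed at most once, so this bounds the running time on every input when
each instruction takes unit time (and it also bounds the length of the program). -/
def Code.size {P R : Type} : Code P R → ℕ
  | .skip => 0
  | .one _ => 1
  | .copy _ _ => 1
  | .arith _ _ _ _ => 1
  | .prim _ _ _ _ => 1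
  | .ifLe _ _ c₁ c₂ => 1 + c₁.size + c₂.size
  | .seq c₁ c₂ => c₁.size + c₂.size

/-- A program with real inputs indexed by `ι` and real outputs indexed by `κ`: a code over the input
registers and work registers `W`, and the list of registers from which the outputs are read. -/
structure Prog (P ι κ : Type) where
  W : Type
  code : Code P (ι ⊕ W)
  out : κ → ι ⊕ W

/-- The outputs on input `x`; work registers are initially zero. -/
def Prog.eval {P ι κ : Type} (T : Prog P ι κ) (φ : P → ℝ → ℝ → ℝ) (x : ι → ℝ) : κ → ℝ :=
  fun k => T.code.run φ (Sum.elim x fun _ => 0) (T.out k)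

/-- The outputs of a program that uses arithmetic only. -/
def Prog.evalArith {ι κ : Type} (T : Prog Empty ι κ) (x : ι → ℝ) : κ → ℝ :=
  T.eval (fun f => f.elim) x

/-- The running time bound of a program: its number of instructions. -/
def Prog.cost {P ι κ : Type} (T : Prog P ι κ) : ℕ := T.code.size

/-- The number of reals that a program outputs. -/
def Prog.numOut {P ι κ : Type} [Fintype κ] (_ : Prog P ι κ) : ℕ := Fintype.card κ

/-! ### Empirical risk of a generalized linear model -/

/-- The average empirical risk `w ↦ (1/n) ∑ᵢ ℓ(⟨xᵢ, w⟩; yᵢ)`, where `xᵢ` is the `i`-th row of `X`. -/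
def empiricalRisk {n d : ℕ} (ℓ : ℝ → ℝ → ℝ) (X : Matrix (Fin n) (Fin d) ℝ) (y : Fin n → ℝ)
    (w : EuclideanSpace ℝ (Fin d)) : ℝ :=
  (1 / (n : ℝ)) * ∑ i, ℓ ((X *ᵥ w.ofLp) i) (y i)

/-- The partial derivative `ℓ'(u; y)` of the loss with respect to its first argument. -/
def lossDeriv (ℓ : ℝ → ℝ → ℝ) (u y : ℝ) : ℝ := deriv (fun v => ℓ v y) u

/-- The vector `f'(w)` with entries `ℓ'(⟨xᵢ, w⟩; yᵢ)`. -/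
def lossDerivVec {n d : ℕ} (ℓ : ℝ → ℝ → ℝ) (X : Matrix (Fin n) (Fin d) ℝ) (y : Fin n → ℝ)
    (w : EuclideanSpace ℝ (Fin d)) : Fin n → ℝ :=
  fun i => lossDeriv ℓ ((X *ᵥ w.ofLp) i) (y i)

/-! ### The encoding matrices -/

/-- The `k × m` Vandermonde error-locator matrix `F`, whose row `a` is `(z₁ᵃ, …, zₘᵃ)`. -/
def errorLocator {m : ℕ} (k : ℕ) (z : Fin m → ℝ) : Matrix (Fin k) (Fin m) ℝ :=
  Matrix.of fun a i => z i ^ (a : ℕ)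

/-- The columns of `B` are the basis of the null space of the `k × m` matrix `F` for which the last
`q` rows of `B` (the rows with index at least `k`) form the identity matrix. -/
structure IsSparseNullBasis {m k q : ℕ} (F : Matrix (Fin k) (Fin m) ℝ)
    (B : Matrix (Fin m) (Fin q) ℝ) : Prop where
  linearIndependent : LinearIndependent ℝ fun (j : Fin q) (i : Fin m) => B i j
  span_eq : Submodule.span ℝ (Set.range fun (j : Fin q) (i : Fin m) => B i j)
    = LinearMap.ker F.mulVecLin
  last_rows : ∀ (i : Fin m) (j : Fin q), k ≤ (i : ℕ) →
    B i j = if (i : ℕ) = k + (j : ℕ) then 1 else 0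

/-- The `p × N` encoding matrix of worker `i`: the `i`-th row of `B`, of length `q`, is repeated along
the diagonal (row `a` holds it in columns `a q, …, a q + q - 1`, cut off at the last column). -/
def encodingMatrix {m q : ℕ} (B : Matrix (Fin m) (Fin q) ℝ) (p N : ℕ) (i : Fin m) :
    Matrix (Fin p) (Fin N) ℝ :=
  Matrix.of fun a c =>
    if h : (a : ℕ) * q ≤ (c : ℕ) ∧ (c : ℕ) < (a : ℕ) * q + q then
      B i ⟨(c : ℕ) - (a : ℕ) * q, by omega⟩
    else 0

/-! ### Two-round distributed gradient computation -/

/-- What the master receives in a round in which honest worker `i` sends `u i ∈ ℝᵖ`: at most `t`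
workers are corrupt and deliver anything (or nothing), at most `s` are stragglers whose reply is
erased, and the reply of every other worker arrives unchanged. -/
def Received {m p : ℕ} (s t : ℕ) (u : Fin m → Fin p → ℝ)
    (r : Fin m → Option (Fin p → ℝ)) : Prop :=
  ∃ I J : Finset (Fin m), I.card ≤ t ∧ J.card ≤ s ∧
    (∀ i ∈ J, r i = none) ∧ ∀ i, i ∉ I → i ∉ J → r i = some (u i)

/-- Replies as program inputs: for every worker a flag telling whether a reply arrived, and `p`
reals (zeros if it did not). -/
def replyInput {m p : ℕ} (r : Fin m → Option (Fin p → ℝ)) : Fin m ⊕ Fin m × Fin p → ℝ :=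
  Sum.elim (fun i => if (r i).isSome then 1 else 0)
    fun ij => match r ij.1 with
      | some v => v ij.2
      | none => 0

/-- The programs of a two-round scheme with `m` workers for `n × d` data; none of them depends on
the data. Everybody knows the evaluation points `z ∈ ℝᵐ`, and the master stores the `n` labels.
* `encode`, once: from `z` and `X`, a `p₁ × d` and a `p₂ × n` matrix for each worker to store.
* round 1: the master broadcasts `w ∈ ℝᵈ`, workers reply with `p₁` reals (`worker₁`), from which,
  with the labels, the master computes `n` reals (`master₁`), with the derivative of the loss as an
  additional unit-time primitive.
* round 2: the master broadcasts these `n` reals, workers reply with `p₂` reals (`worker₂`), from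
  which the master computes the gradient (`master₂`). -/
structure Scheme (m n d : ℕ) where
  p₁ : ℕ
  p₂ : ℕ
  encode : Prog Empty (Fin m ⊕ Fin n × Fin d) (Fin m × (Fin p₁ × Fin d ⊕ Fin p₂ × Fin n))
  worker₁ : Prog Empty (Fin p₁ × Fin d ⊕ Fin d) (Fin p₁)
  master₁ : Prog Unit (Fin m ⊕ Fin n ⊕ (Fin m ⊕ Fin m × Fin p₁)) (Fin n)
  worker₂ : Prog Empty (Fin p₂ × Fin n ⊕ Fin n) (Fin p₂)
  master₂ : Prog Empty (Fin m ⊕ (Fin m ⊕ Fin m × Fin p₂)) (Fin d)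

namespace Scheme

variable {m n d : ℕ} (S : Scheme m n d)

/-- The matrix stored at worker `i` for the first round. -/
def stored₁ (z : Fin m → ℝ) (X : Matrix (Fin n) (Fin d) ℝ) (i : Fin m) :
    Matrix (Fin S.p₁) (Fin d) ℝ :=
  Matrix.of fun a c => S.encode.evalArith (Sum.elim z fun e => X e.1 e.2) (i, Sum.inl (a, c))

/-- The matrix stored at worker `i` for the second round. -/
def stored₂ (z : Fin m → ℝ) (X : Matrix (Fin n) (Fin d) ℝ) (i : Fin m) :
    Matrix (Fin S.p₂) (Fin n) ℝ :=
  Matrix.of fun a c => S.encode.evalArith (Sum.elim z fun e => X e.1 e.2) (i, Sum.inr (a, c))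

/-- The reply of an honest worker with stored matrix `A` to the broadcast `w` in round 1. -/
def reply₁ (A : Matrix (Fin S.p₁) (Fin d) ℝ) (w : Fin d → ℝ) : Fin S.p₁ → ℝ :=
  S.worker₁.evalArith (Sum.elim (fun e => A e.1 e.2) w)

/-- The reply of an honest worker with stored matrix `A` to the broadcast `v` in round 2. -/
def reply₂ (A : Matrix (Fin S.p₂) (Fin n) ℝ) (v : Fin n → ℝ) : Fin S.p₂ → ℝ :=
  S.worker₂.evalArith (Sum.elim (fun e => A e.1 e.2) v)

/-- What the master computes from labels and replies after round 1 (and broadcasts in round 2). -/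
def decode₁ (ℓ : ℝ → ℝ → ℝ) (z : Fin m → ℝ) (y : Fin n → ℝ)
    (r : Fin m → Option (Fin S.p₁ → ℝ)) : Fin n → ℝ :=
  S.master₁.eval (fun _ => lossDeriv ℓ) (Sum.elim z (Sum.elim y (replyInput r)))

/-- What the master outputs from the replies after round 2. -/
def decode₂ (z : Fin m → ℝ) (r : Fin m → Option (Fin S.p₂ → ℝ)) : Fin d → ℝ :=
  S.master₂.evalArith (Sum.elim z (replyInput r))

/-- Both rounds are coded matrix–vector multiplications with the encoding matrices made from `B`:
worker `i` stores `Sᵢ⁽¹⁾ X` and `Sᵢ⁽²⁾ Xᵀ`, and multiplies the stored matrix with the broadcast. -/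
def IsCodedBy {q : ℕ} (z : Fin m → ℝ) (B : Matrix (Fin m) (Fin q) ℝ) : Prop :=
  (∀ X i, S.stored₁ z X i = encodingMatrix B S.p₁ n i * X) ∧
  (∀ X i, S.stored₂ z X i = encodingMatrix B S.p₂ d i * Xᵀ) ∧
  (∀ A w, S.reply₁ A w = A *ᵥ w) ∧
  (∀ A v, S.reply₂ A v = A *ᵥ v)

/-- The two-round computation is exact: whatever at most `t` corrupt workers and `s` stragglers do in
each round (the sets may change between the rounds, and corrupt replies may depend on everything),
the master obtains `f'(w)` after round 1 and outputs the gradient of the average empirical risk at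
`w` after round 2, for all data, all losses that are differentiable in the first argument and all `w`. -/
def ComputesGradient (s t : ℕ) (z : Fin m → ℝ) : Prop :=
  ∀ (X : Matrix (Fin n) (Fin d) ℝ) (y : Fin n → ℝ) (ℓ : ℝ → ℝ → ℝ),
    (∀ i, Differentiable ℝ fun u => ℓ u (y i)) →
    ∀ (w : EuclideanSpace ℝ (Fin d)) (r₁ : Fin m → Option (Fin S.p₁ → ℝ)),
      Received s t (fun i => S.reply₁ (S.stored₁ z X i) w.ofLp) r₁ →
      S.decode₁ ℓ z y r₁ = lossDerivVec ℓ X y w ∧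
      ∀ r₂ : Fin m → Option (Fin S.p₂ → ℝ),
        Received s t (fun i => S.reply₂ (S.stored₂ z X i) (S.decode₁ ℓ z y r₁)) r₂ →
        HasGradientAt (empiricalRisk ℓ X y) (WithLp.toLp 2 (S.decode₂ z r₂)) w

/-- Total storage in reals: the encoded matrices at the workers and the labels at the master. -/
def storage : ℕ := S.encode.numOut + n

/-- Time for one gradient computation at a worker node. -/
def workerCost : ℕ := S.worker₁.cost + S.worker₂.cost

/-- Time for one gradient computation at the master node. -/
def masterCost : ℕ := S.master₁.cost + S.master₂.cost

/-- Number of reals sent by each worker in one gradient computation. -/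
def workerSends : ℕ := S.worker₁.numOut + S.worker₂.numOut

/-- Number of reals broadcast by the master in one gradient computation: `w`, and the output of its
computation after round 1. -/
def masterBroadcasts : ℕ := d + S.master₁.numOut

end Scheme

end

/-! Write k = 2(s+t), q = m - k, τ = s+t. The null space of the error-locator matrix is a
generalized Reed–Solomon code: by Lagrange's formula for the leading coefficient, a null vector,
scaled by the node weights ∏ (z_i - z_l), consists of the values of a polynomial g of degree < q at
the nodes (`exists_polynomial_of_sum_pow_mul_eq_zero`). For each block index, the corresponding
entries of the m honest replies form such a null vector, and its last q coordinates are the entries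
of Xw or Xᵀf'(w) in that block. A missing reply is read as zeros, so at most τ coordinates of a
block are wrong (`correctErrors_replyBlock`).

Decoding is rational interpolation in the style of Welch and Berlekamp. Pairs (N, W) of polynomials
with N(z_i) = ρ_i W(z_i) at the scaled received values ρ_i form a module of rank two; a basis with
controlled degrees is updated one node at a time (`isInterpBasis_interpState`). After m nodes the
lower pair has deg N < m - τ and deg W ≤ τ, and N - gW vanishes at the at least m - τ correct nodes,
whence N = gW (`ratioValue_interpState`). No polynomial division is needed: g(z_j) is ρ_j where
W(z_j) ≠ 0, and N'(z_j)/W'(z_j) otherwise, because the determinant of the basis has only simple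
zeros.

For the running time, polynomials are represented by their values and derivatives at the m nodes. An
update then takes O(m) operations and a block O(m²) (`derives_correctErrors`). Encoding is cheap
because q rows of the code basis are unit vectors, so only k workers need arithmetic
(`derives_encodingMatrix_mul`). All final bounds come from m ≤ (1+ε)q. Programs are built by a
calculus of available functions: a register is named by the function of the input that it holds, so
correctness and cost are proved together. -/

noncomputable section

/-! ### Programs whose registers are named by the functions of the input that they hold -/

section Programs

variable {P ι Ω : Type}

/-- Some code with at most `c` instructions makes every function in `B` available: on the input
`x ω`, with primitives `φ ω`, the function is an input or the register named by it holds its value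
at `ω`. -/
def Reach (φ : Ω → P → ℝ → ℝ → ℝ) (x : Ω → ι → ℝ) (c : ℕ) (B : Set (Ω → ℝ)) : Prop :=
  ∃ code : Code P (ι ⊕ (Ω → ℝ)), code.size ≤ c ∧
    (∀ ω i, code.run (φ ω) (Sum.elim (x ω) fun _ => 0) (Sum.inl i) = x ω i) ∧
    ∀ f ∈ B, (∃ i, f = fun ω => x ω i) ∨
      ∀ ω, code.run (φ ω) (Sum.elim (x ω) fun _ => 0) (Sum.inr f) = f ω

/-- The functions in `A` can be computed from those in `B` with `k` further instructions. -/
def Derives (φ : Ω → P → ℝ → ℝ → ℝ) (x : Ω → ι → ℝ) (B A : Set (Ω → ℝ)) (k : ℕ) : Prop :=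
  ∀ c B', B ⊆ B' → Reach φ x c B' → Reach φ x (c + k) (B' ∪ A)

/-- The functions that are available before the first instruction. -/
def baseRegs (x : Ω → ι → ℝ) : Set (Ω → ℝ) := insert (fun _ => 0) (Set.range fun i ω => x ω i)

variable {φ : Ω → P → ℝ → ℝ → ℝ} {x : Ω → ι → ℝ} {A A' B B' : Set (Ω → ℝ)} {k k' : ℕ}

theorem reach_base : Reach φ x 0 (baseRegs x) := by
  refine ⟨.skip, le_rfl, fun _ _ => rfl, ?_⟩
  rintro f (rfl | ⟨i, rfl⟩)
  · exact Or.inr fun _ => rfl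
  · exact Or.inl ⟨i, rfl⟩

theorem Reach.mono {c c' : ℕ} (h : Reach φ x c B) (hc : c ≤ c') (hB : B' ⊆ B) :
    Reach φ x c' B' := by
  obtain ⟨code, h1, h2, h3⟩ := h
  exact ⟨code, h1.trans hc, h2, fun f hf => h3 f (hB hf)⟩

/-- Here Ω is the set of all situations in which the program may run. The code and the output
registers are chosen before ω, so a single program serves every input and every interpretation of
the primitives. -/
theorem Derives.exists_prog {κ : Type} (h : Derives φ x (baseRegs x) A k) (f : κ → Ω → ℝ)
    (hf : ∀ j, f j ∈ baseRegs x ∪ A) :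
    ∃ T : Prog P ι κ, T.cost ≤ k ∧ ∀ ω j, T.eval (φ ω) (x ω) j = f j ω := by
  classical
  obtain ⟨code, h1, h2, h3⟩ := h 0 _ subset_rfl reach_base
  have h4 : ∀ j, ∃ r : ι ⊕ (Ω → ℝ), ∀ ω,
      code.run (φ ω) (Sum.elim (x ω) fun _ => 0) r = f j ω := by
    intro j
    rcases h3 _ (hf j) with ⟨i, hi⟩ | h
    · exact ⟨Sum.inl i, fun ω => by rw [h2, hi]⟩
    · exact ⟨_, h⟩
  choose out hout using h4
  exact ⟨⟨_, code, out⟩, by simpa [Prog.cost] using h1, fun ω j => hout j ω⟩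

theorem Derives.mono (h : Derives φ x B A k) (hB : B ⊆ B') (hA : A' ⊆ A) (hk : k ≤ k') :
    Derives φ x B' A' k' := fun c D hD hc =>
  (h c D (hB.trans hD) hc).mono (by omega) (Set.union_subset_union_right _ hA)

theorem Derives.of_subset (h : A ⊆ B) : Derives φ x B A 0 := fun _ _ hD hc =>
  hc.mono le_rfl (Set.union_subset subset_rfl (h.trans hD))

/-- The quantification over supersets in `Derives` is what makes this work: appended code keeps
everything that is already available, so instruction counts simply add. -/
theorem Derives.trans (h : Derives φ x B A k) (h' : Derives φ x (B ∪ A) A' k') :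
    Derives φ x B (A ∪ A') (k + k') := fun c D hD hc => by
  have := h' _ _ (Set.union_subset_union_left A hD) (h c D hD hc)
  rwa [Set.union_assoc, add_assoc] at this

theorem Derives.comp (h : Derives φ x B A k) (h' : Derives φ x (B ∪ A) A' k') :
    Derives φ x B A' (k + k') :=
  (h.trans h').mono subset_rfl Set.subset_union_right le_rfl

theorem Derives.union (h : Derives φ x B A k) (h' : Derives φ x B A' k') :
    Derives φ x B (A ∪ A') (k + k') :=
  h.trans (h'.mono Set.subset_union_left subset_rfl le_rfl)

/-- Finitely many sets of functions, each at the same cost. -/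
theorem Derives.biUnion {J : Type*} (s : Finset J) (F : J → Set (Ω → ℝ))
    (h : ∀ j ∈ s, Derives φ x B (F j) k) : Derives φ x B (⋃ j ∈ s, F j) (s.card * k) := by
  classical
  induction s using Finset.induction_on with
  | empty => exact (Derives.of_subset (by simp)).mono subset_rfl subset_rfl (by simp)
  | insert a s ha ih =>
    refine ((h a (by simp)).union (ih fun j hj => h j (by simp [hj]))).mono subset_rfl ?_ ?_
    · simp
    · rw [Finset.card_insert_of_notMem ha]; linarith

theorem Derives.image {J : Type*} (s : Finset J) (f : J → Ω → ℝ)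
    (h : ∀ j ∈ s, Derives φ x B {f j} k) : Derives φ x B (f '' s) (s.card * k) :=
  (Derives.biUnion s (fun j => {f j}) h).mono subset_rfl (by
    rintro _ ⟨j, hj, rfl⟩; simp only [Set.mem_iUnion]; exact ⟨j, hj, rfl⟩) le_rfl

/-- `N` rounds, each at the same cost. -/
theorem Derives.iterate (F : ℕ → Set (Ω → ℝ)) (N : ℕ)
    (h : ∀ i < N, Derives φ x (B ∪ F i) (F (i + 1)) k) :
    Derives φ x (B ∪ F 0) (F N) (N * k) := by
  induction N with
  | zero => exact (Derives.of_subset Set.subset_union_right).mono subset_rfl subset_rfl (by simp)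
  | succ N ih =>
    refine ((ih fun i hi => h i (by omega)).comp ((h N (by omega)).mono ?_ subset_rfl le_rfl)).mono
      subset_rfl subset_rfl (by rw [add_mul, one_mul])
    exact Set.union_subset_union_left _ Set.subset_union_left

/-- One more function, given code that assigns its value to the register named by it. -/
theorem Derives.of_code (f : Ω → ℝ)
    (h : ∀ loc : (Ω → ℝ) → ι ⊕ (Ω → ℝ), ∃ c : Code P (ι ⊕ (Ω → ℝ)), c.size ≤ k ∧
      ∀ ω ρ, (∀ g ∈ B, ρ (loc g) = g ω) → c.run (φ ω) ρ (Sum.inr f) = f ω ∧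
        ∀ r ≠ Sum.inr f, c.run (φ ω) ρ r = ρ r) :
    Derives φ x B {f} k := by
  rintro c D hD ⟨code, h1, h2, h3⟩
  -- If `f` is available nothing has to be run. Otherwise the register named `f` carries no function
  -- of `D`, so overwriting it destroys nothing that must be kept.
  by_cases hf : f ∈ D
  · exact Reach.mono ⟨code, h1, h2, h3⟩ (by omega) (Set.union_subset subset_rfl (by simpa using hf))
  have h4 : ∀ g : Ω → ℝ, ∃ r : ι ⊕ (Ω → ℝ), g ∈ B → ∀ ω,
      code.run (φ ω) (Sum.elim (x ω) fun _ => 0) r = g ω := by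
    intro g
    by_cases hg : g ∈ B
    · rcases h3 _ (hD hg) with ⟨i, hi⟩ | h
      · exact ⟨Sum.inl i, fun _ ω => by rw [h2, hi]⟩
      · exact ⟨_, fun _ => h⟩
    · exact ⟨Sum.inr g, fun h => absurd h hg⟩
  choose loc hloc using h4
  obtain ⟨c', h5, h6⟩ := h loc
  have h7 := fun ω => h6 ω (code.run (φ ω) (Sum.elim (x ω) fun _ => 0)) fun g hg => hloc g hg ω
  refine ⟨code.seq c', by simp only [Code.size]; omega, fun ω i => ?_, ?_⟩
  · rw [Code.run, (h7 ω).2 _ (by simp), h2]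
  · rintro g (hg | hg)
    · rcases h3 g hg with h | h
      · exact Or.inl h
      · refine Or.inr fun ω => ?_
        rw [Code.run, (h7 ω).2, h]
        rintro h8
        exact hf (Sum.inr_injective h8 ▸ hg)
    · obtain rfl : g = f := hg
      exact Or.inr fun ω => (h7 ω).1

/-! ### Single instructions, selections, sums and products -/

theorem Derives.one : Derives φ x B {fun _ => 1} 1 :=
  Derives.of_code _ fun _ => ⟨.one (Sum.inr fun _ => 1), le_rfl, fun ω ρ _ => by
    simp +contextual [Code.run]⟩

theorem Derives.arith (o : ArithOp) {f g : Ω → ℝ} (hf : f ∈ B) (hg : g ∈ B) :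
    Derives φ x B {fun ω => o.apply (f ω) (g ω)} 1 :=
  Derives.of_code _ fun loc => ⟨.arith o (Sum.inr fun ω => o.apply (f ω) (g ω)) (loc f) (loc g), le_rfl, fun ω ρ h => by
    simp +contextual [Code.run, h f hf, h g hg]⟩

theorem Derives.add {f g : Ω → ℝ} (hf : f ∈ B) (hg : g ∈ B) :
    Derives φ x B {fun ω => f ω + g ω} 1 := Derives.arith .add hf hg

theorem Derives.sub {f g : Ω → ℝ} (hf : f ∈ B) (hg : g ∈ B) :
    Derives φ x B {fun ω => f ω - g ω} 1 := Derives.arith .sub hf hg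

theorem Derives.mul {f g : Ω → ℝ} (hf : f ∈ B) (hg : g ∈ B) :
    Derives φ x B {fun ω => f ω * g ω} 1 := Derives.arith .mul hf hg

theorem Derives.div {f g : Ω → ℝ} (hf : f ∈ B) (hg : g ∈ B) :
    Derives φ x B {fun ω => f ω / g ω} 1 := Derives.arith .div hf hg

theorem Derives.prim (p : P) {f g : Ω → ℝ} (hf : f ∈ B) (hg : g ∈ B) :
    Derives φ x B {fun ω => φ ω p (f ω) (g ω)} 1 :=
  Derives.of_code _ fun loc => ⟨.prim p (Sum.inr fun ω => φ ω p (f ω) (g ω)) (loc f) (loc g), le_rfl, fun ω ρ h => by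
    simp +contextual [Code.run, h f hf, h g hg]⟩

-- The cost counts the comparison and one copy in each of the two branches.
open Classical in
theorem Derives.ite_le {f g u v : Ω → ℝ} (hf : f ∈ B) (hg : g ∈ B) (hu : u ∈ B) (hv : v ∈ B) :
    Derives φ x B {fun ω => if f ω ≤ g ω then u ω else v ω} 3 :=
  Derives.of_code _ fun loc =>
    ⟨.ifLe (loc f) (loc g) (.copy (Sum.inr fun ω => if f ω ≤ g ω then u ω else v ω) (loc u))
      (.copy (Sum.inr fun ω => if f ω ≤ g ω then u ω else v ω) (loc v)), le_rfl, fun ω ρ h => by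
      simp only [Code.run, h f hf, h g hg, h u hu, h v hv]
      split_ifs <;> simp +contextual⟩

-- Equality is tested by two comparisons, `0 ≤ f` and then `f ≤ 0`, each costing 3.
open Classical in
theorem Derives.ite_eq_zero {f u v : Ω → ℝ} (h0 : (fun _ => 0) ∈ B) (hf : f ∈ B) (hu : u ∈ B)
    (hv : v ∈ B) : Derives φ x B {fun ω => if f ω = 0 then u ω else v ω} 6 := by
  refine ((Derives.ite_le h0 hf hu hv).comp
    (Derives.ite_le (f := f) (g := fun _ => 0) (u := fun ω => if 0 ≤ f ω then u ω else v ω) (v := v)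
      (by simp [hf]) (by simp [h0]) (by simp) (by simp [hv]))).mono subset_rfl ?_ le_rfl
  rw [Set.singleton_subset_iff, Set.mem_singleton_iff]
  funext ω
  by_cases h : f ω = 0
  · simp [h]
  · rcases lt_or_gt_of_ne h with h' | h' <;> simp [h, h'.le, h'.not_ge]

open Classical in
/-- Selection by a flag. -/
theorem Derives.ite {p : Ω → Prop} {u v : Ω → ℝ} (h1 : (fun _ => 1) ∈ B)
    (hp : (fun ω => if p ω then (1 : ℝ) else 0) ∈ B) (hu : u ∈ B) (hv : v ∈ B) :
    Derives φ x B {fun ω => if p ω then u ω else v ω} 3 := by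
  refine (Derives.ite_le h1 hp hu hv).mono subset_rfl ?_ le_rfl
  rw [Set.singleton_subset_iff, Set.mem_singleton_iff]
  funext ω
  by_cases h : p ω <;> simp [h]

theorem Derives.sum {J : Type*} (s : Finset J) (f : J → Ω → ℝ) (h0 : (fun _ => 0) ∈ B)
    (h : ∀ j ∈ s, f j ∈ B) : Derives φ x B {fun ω => ∑ j ∈ s, f j ω} s.card := by
  classical
  induction s using Finset.induction_on with
  | empty => exact (Derives.of_subset (by simpa using h0))
  | insert a s ha ih =>
    rw [Finset.card_insert_of_notMem ha]
    simp only [Finset.sum_insert ha]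
    refine (ih fun j hj => h j (by simp [hj])).comp (Derives.add ?_ ?_)
    · exact Or.inl (h a (by simp))
    · exact Or.inr rfl

theorem Derives.prod {J : Type*} (s : Finset J) (f : J → Ω → ℝ) (h1 : (fun _ => 1) ∈ B)
    (h : ∀ j ∈ s, f j ∈ B) : Derives φ x B {fun ω => ∏ j ∈ s, f j ω} s.card := by
  classical
  induction s using Finset.induction_on with
  | empty => exact (Derives.of_subset (by simpa using h1))
  | insert a s ha ih =>
    rw [Finset.card_insert_of_notMem ha]
    simp only [Finset.prod_insert ha]
    refine (ih fun j hj => h j (by simp [hj])).comp (Derives.mul ?_ ?_)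
    · exact Or.inl (h a (by simp))
    · exact Or.inr rfl

theorem Derives.sum_mul {J : Type*} (s : Finset J) (f g : J → Ω → ℝ) (h0 : (fun _ => 0) ∈ B)
    (hf : ∀ j ∈ s, f j ∈ B) (hg : ∀ j ∈ s, g j ∈ B) :
    Derives φ x B {fun ω => ∑ j ∈ s, f j ω * g j ω} (s.card * 2) :=
  ((Derives.image s (fun j ω => f j ω * g j ω) fun j hj => Derives.mul (hf j hj) (hg j hj)).comp
    (Derives.sum s _ (Or.inl h0) fun j hj => Or.inr ⟨j, hj, rfl⟩)).mono subset_rfl subset_rfl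
    (by omega)

/-- A function composed of two operations. -/
theorem Derives.comp_singleton {f g : Ω → ℝ} (h : Derives φ x B {f} k)
    (h' : Derives φ x (insert f B) {g} k') : Derives φ x B {g} (k + k') :=
  h.comp (h'.mono (by rw [Set.insert_eq, Set.union_comm]) subset_rfl le_rfl)

end Programs

/-! ### Decoding by rational interpolation -/

section RationalInterpolation

open Polynomial

/-- The defect `N(ζ) - ρ W(ζ)` of a pair `(N, W)` of polynomials, as a rational function `N / W`
with value `ρ` at `ζ`. -/
def discrepancy (ζ ρ : ℝ) (v : Bool → ℝ[X]) : ℝ :=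
  (v false).eval ζ - ρ * (v true).eval ζ

/-- Two pairs of polynomials, each with a degree bound. -/
abbrev InterpState : Type := Bool → (Bool → ℝ[X]) × ℕ

/-- The first pair is the one to be used for eliminating the discrepancy of the other. -/
def HasPivot (ζ ρ : ℝ) (s : InterpState) : Prop :=
  discrepancy ζ ρ (s false).1 ≠ 0 ∧
    (discrepancy ζ ρ (s true).1 = 0 ∨ (s false).2 ≤ (s true).2)

open Classical in
/-- Exchange the two pairs if the second one is the better pivot. -/
def orient (ζ ρ : ℝ) (s : InterpState) : InterpState := fun x =>
  if HasPivot ζ ρ s then s x else s !x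

/-- Make both pairs interpolate the value `ρ` at `ζ`. -/
def eliminate (ζ ρ : ℝ) (s : InterpState) : InterpState
  | false => (fun e => (X - C ζ) * (s false).1 e, (s false).2 + 1)
  | true => (fun e => C (discrepancy ζ ρ (s false).1) * (s true).1 e
      - C (discrepancy ζ ρ (s true).1) * (s false).1 e, (s true).2)

/-- The pairs `(1, 0)` and `(0, 1)`. -/
def initState (q : ℕ) : InterpState
  | false => (fun e => cond e 0 1, 1)
  | true => (fun e => cond e 1 0, q)

/-- The state after interpolating at the first points of a sequence. -/
def interpState (q : ℕ) (z ρ : ℕ → ℝ) : ℕ → InterpState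
  | 0 => initState q
  | i + 1 => eliminate (z i) (ρ i) (orient (z i) (ρ i) (interpState q z ρ i))

/-- The two pairs form a basis of the module of pairs that interpolate at the first `i` points, with
small degrees. -/
structure IsInterpBasis (q : ℕ) (z ρ : ℕ → ℝ) (i : ℕ) (s : InterpState) : Prop where
  discrepancy_eq : ∀ x, ∀ j < i, discrepancy (z j) (ρ j) (s x).1 = 0
  -- A bound D stands for deg N < D and deg W ≤ D - q, with W = 0 if D < q: denominators carry
  -- weight q, since N is to become gW with deg g < q.
  coeff_eq : ∀ x e n, (s x).2 < n + cond e q 1 → ((s x).1 e).coeff n = 0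
  degree_sum : (s false).2 + (s true).2 = 1 + q + i
  det_eq : ∃ c : ℝ, c ≠ 0 ∧ (s false).1 false * (s true).1 true
    - (s true).1 false * (s false).1 true = C c * ∏ j ∈ Finset.range i, (X - C (z j))

theorem isInterpBasis_initState (q : ℕ) (z ρ : ℕ → ℝ) : IsInterpBasis q z ρ 0 (initState q) where
  discrepancy_eq := by simp
  coeff_eq := by
    rintro (_ | _) (_ | _) n h <;> simp [initState, coeff_one] at * <;> omega
  degree_sum := by simp [initState]
  det_eq := ⟨1, one_ne_zero, by simp [initState]⟩

theorem IsInterpBasis.swap {q i : ℕ} {z ρ : ℕ → ℝ} {s : InterpState}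
    (h : IsInterpBasis q z ρ i s) : IsInterpBasis q z ρ i fun x => s !x where
  discrepancy_eq x := h.discrepancy_eq _
  coeff_eq x := h.coeff_eq _
  degree_sum := by have := h.degree_sum; simp only [Bool.not_false, Bool.not_true]; omega
  det_eq := by
    obtain ⟨c, hc, h⟩ := h.det_eq
    refine ⟨-c, neg_ne_zero.2 hc, ?_⟩
    simp only [Bool.not_false, Bool.not_true, map_neg, neg_mul, ← h]
    ring

theorem IsInterpBasis.orient {q i : ℕ} {z ρ : ℕ → ℝ} {s : InterpState} (ζ η : ℝ)
    (h : IsInterpBasis q z ρ i s) : IsInterpBasis q z ρ i (orient ζ η s) := by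
  by_cases hp : HasPivot ζ η s
  · have : _root_.orient ζ η s = s := funext fun x => if_pos hp
    rwa [this]
  · have : _root_.orient ζ η s = fun x => s !x := funext fun x => if_neg hp
    rw [this]
    exact h.swap

/-- If both discrepancies vanished, the rows of values at `z i` would be proportional to (ρ, 1) and
the determinant would vanish there; but its only zeros are the earlier nodes. -/
theorem IsInterpBasis.exists_discrepancy_ne_zero {q i : ℕ} {z ρ : ℕ → ℝ} {s : InterpState}
    (h : IsInterpBasis q z ρ i s) (hz : ∀ j < i, z i ≠ z j) :
    ∃ x, discrepancy (z i) (ρ i) (s x).1 ≠ 0 := by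
  by_contra! h0
  obtain ⟨c, hc, hd⟩ := h.det_eq
  have h1 := h0 false
  have h2 := h0 true
  simp only [discrepancy, sub_eq_zero] at h1 h2
  have h3 := congrArg (eval (z i)) hd
  simp only [eval_sub, eval_mul, h1, h2, eval_C, eval_prod, eval_X] at h3
  have h4 : c * ∏ j ∈ Finset.range i, (z i - z j) ≠ 0 :=
    mul_ne_zero hc (Finset.prod_ne_zero_iff.2 fun j hj =>
      sub_ne_zero.2 (hz j (Finset.mem_range.1 hj)))
  exact h4 (h3 ▸ by ring)

/-- When the first pair is no pivot, either its discrepancy is zero, so that the other's is not, or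
both are nonzero and the second pair has the strictly smaller bound. In both cases exchanging helps.
-/
theorem IsInterpBasis.hasPivot_orient {q i : ℕ} {z ρ : ℕ → ℝ} {s : InterpState}
    (h : IsInterpBasis q z ρ i s) (hz : ∀ j < i, z i ≠ z j) :
    HasPivot (z i) (ρ i) (_root_.orient (z i) (ρ i) s) := by
  by_cases hp : HasPivot (z i) (ρ i) s
  · have : _root_.orient (z i) (ρ i) s = s := funext fun x => if_pos hp
    rwa [this]
  · have : _root_.orient (z i) (ρ i) s = fun x => s !x := funext fun x => if_neg hp
    rw [this]
    obtain ⟨x, hx⟩ := h.exists_discrepancy_ne_zero hz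
    simp only [HasPivot, Bool.not_false, Bool.not_true] at hp ⊢
    push Not at hp
    by_cases h1 : discrepancy (z i) (ρ i) (s false).1 = 0
    · cases x
      · exact absurd h1 hx
      · exact ⟨hx, Or.inl h1⟩
    · exact ⟨(hp h1).1, Or.inr (hp h1).2.le⟩

/-- Discrepancies are linear in the pair, so old conditions survive and the new one is forced. The
combination does not raise the second bound, because a pivot has the smaller bound unless its
multiplier is zero; the factor X - z_i raises the first by one. The determinant gains this factor
and a nonzero constant. -/
theorem IsInterpBasis.eliminate {q i : ℕ} {z ρ : ℕ → ℝ} {s : InterpState}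
    (h : IsInterpBasis q z ρ i s) (hp : HasPivot (z i) (ρ i) s) :
    IsInterpBasis q z ρ (i + 1) (eliminate (z i) (ρ i) s) where
  discrepancy_eq := by
    intro x j hj
    rcases Nat.lt_succ_iff_lt_or_eq.1 hj with hj | rfl
    · have h1 := h.discrepancy_eq false j hj
      have h2 := h.discrepancy_eq true j hj
      simp only [discrepancy] at h1 h2
      cases x
      · simp only [discrepancy, _root_.eliminate, eval_mul]
        linear_combination (eval (z j) (X - C (z i))) * h1
      · simp only [discrepancy, _root_.eliminate, eval_mul, eval_sub, eval_C]
        linear_combination (eval (z i) ((s false).1 false) - ρ i * eval (z i) ((s false).1 true)) * h2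
          - (eval (z i) ((s true).1 false) - ρ i * eval (z i) ((s true).1 true)) * h1
    · cases x
      · simp [discrepancy, _root_.eliminate]
      · simp only [discrepancy, _root_.eliminate, eval_mul, eval_sub, eval_C]
        ring
  coeff_eq := by
    rintro (_ | _) e n hn
    · simp only [_root_.eliminate] at hn ⊢
      rw [sub_mul, coeff_sub, coeff_C_mul, h.coeff_eq false e n (by omega), mul_zero, sub_zero]
      cases n with
      | zero => simp
      | succ n => rw [coeff_X_mul]; exact h.coeff_eq false e n (by omega)
    · simp only [_root_.eliminate] at hn ⊢
      rw [coeff_sub, coeff_C_mul, coeff_C_mul, h.coeff_eq true e n hn]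
      rcases hp.2 with h0 | h0
      · simp [h0]
      · simp [h.coeff_eq false e n (by omega)]
  degree_sum := by
    have := h.degree_sum
    simp only [_root_.eliminate]; omega
  det_eq := by
    obtain ⟨c, hc, h1⟩ := h.det_eq
    refine ⟨discrepancy (z i) (ρ i) (s false).1 * c, mul_ne_zero hp.1 hc, ?_⟩
    simp only [_root_.eliminate, Finset.prod_range_succ, C_mul]
    linear_combination (C (discrepancy (z i) (ρ i) (s false).1) * (X - C (z i))) * h1

theorem isInterpBasis_interpState (q : ℕ) {z : ℕ → ℝ} (ρ : ℕ → ℝ) {m : ℕ}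
    (hz : Set.InjOn z (Finset.range m)) {i : ℕ} (hi : i ≤ m) :
    IsInterpBasis q z ρ i (interpState q z ρ i) := by
  induction i with
  | zero => exact isInterpBasis_initState q z ρ
  | succ i ih =>
    have h := ih (by omega)
    refine (h.orient _ _).eliminate (h.hasPivot_orient fun j hj hij => ?_)
    have := hz (by simpa using hi) (by simp; omega) hij
    omega

/-- Of two pairs, the polynomials of the one with the smaller degree bound. -/
def lowerPair (s : InterpState) : Bool → ℝ[X] := fun e =>
  if (s false).2 ≤ (s true).2 then (s false).1 e else (s true).1 e

/-- The value at `ζ` of `N / W`, if `W(ζ) ≠ 0` and the value is known to be `ρ`, or if `ζ` is a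
simple zero of `N` and `W`. -/
def ratioValue (v : Bool → ℝ[X]) (ζ ρ : ℝ) : ℝ :=
  open Classical in
  if (v true).eval ζ = 0 then (derivative (v false)).eval ζ / (derivative (v true)).eval ζ else ρ

/-- Nearly correct values of a polynomial of degree less than `q` at `m` points are corrected. -/
theorem ratioValue_interpState {m q τ : ℕ} (hm : q + 2 * τ = m) {z ρ : ℕ → ℝ}
    (hz : Set.InjOn z (Finset.range m)) {g : ℝ[X]} (hg : g.degree < q)
    (hρ : ((Finset.range m).filter fun i => ρ i ≠ g.eval (z i)).card ≤ τ) {j : ℕ} (hj : j < m) :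
    ratioValue (lowerPair (interpState q z ρ m)) (z j) (ρ j) = g.eval (z j) := by
  have hb := isInterpBasis_interpState q ρ hz le_rfl
  set s := interpState q z ρ m
  -- The bounds add up to 1 + q + m = 2(q + τ) + 1, so the smaller one is at most q + τ = m - τ.
  obtain ⟨x, hx, hd⟩ : ∃ x, lowerPair s = (s x).1 ∧ (s x).2 ≤ m - τ := by
    have := hb.degree_sum
    by_cases h : (s false).2 ≤ (s true).2
    · exact ⟨false, funext fun e => if_pos h, by omega⟩
    · exact ⟨true, funext fun e => if_neg h, by omega⟩
  rw [hx]
  set N := (s x).1 false with hN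
  set W := (s x).1 true with hW
  have hNW : N = g * W := by
    -- N - gW has degree < m - τ and vanishes at every node where ρ is correct; there are at least m
    -- - τ of those.
    rw [← sub_eq_zero]
    refine eq_zero_of_degree_lt_of_eval_index_eq_zero (v := z)
      (s := (Finset.range m).filter fun i => ¬ ρ i ≠ g.eval (z i))
      (hz.mono (by simp [Set.subset_def]; tauto)) ?_ ?_
    · have hc := Finset.card_filter_add_card_filter_not (s := Finset.range m)
        (fun i => ρ i ≠ g.eval (z i))
      simp only [ne_eq, Finset.card_range] at hc hρ ⊢
      refine lt_of_lt_of_le (b := ((m - τ : ℕ) : WithBot ℕ)) ?_ (by norm_cast; omega)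
      refine (degree_sub_le _ _).trans_lt (max_lt ?_ ?_)
      · rw [degree_lt_iff_coeff_zero]
        exact fun n hn => hb.coeff_eq x false n (by simp only [cond_false]; omega)
      · by_cases hg0 : g = 0
        · simp [hg0]
        have hq : 1 ≤ q := by
          rw [degree_eq_natDegree hg0] at hg
          have := WithBot.coe_lt_coe.1 hg
          simp only [Nat.cast_id] at this
          omega
        have hWd : W.degree ≤ (τ : ℕ) := by
          rw [degree_le_iff_coeff_zero]
          intro n hn
          have := WithBot.coe_lt_coe.1 hn
          simp only [Nat.cast_id] at this
          exact hb.coeff_eq x true n (by simp only [cond_true]; omega)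
        have hgd : g.degree ≤ ((q - 1 : ℕ) : WithBot ℕ) := by
          rw [degree_eq_natDegree hg0] at hg ⊢
          have := WithBot.coe_lt_coe.1 hg
          simp only [Nat.cast_id] at this
          exact_mod_cast (by omega : g.natDegree ≤ q - 1)
        rw [degree_mul]
        refine (add_le_add hgd hWd).trans_lt ?_
        exact_mod_cast (by omega : q - 1 + τ < m - τ)
    · intro i hi
      simp only [Finset.mem_filter, Finset.mem_range, not_not] at hi
      have := hb.discrepancy_eq x i hi.1
      simp only [discrepancy, hi.2] at this
      simpa using this
  rw [ratioValue, ← hN, ← hW]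
  split_ifs with h0
  -- If W and W' both vanished at z_j, then so would N = gW and N', and the determinant would have a
  -- double zero at z_j. With W'(z_j) ≠ 0, differentiating N = gW gives N'(z_j)/W'(z_j) = g(z_j).
  · have hW1 : (derivative W).eval (z j) ≠ 0 := by
      intro h1
      obtain ⟨c, hc, hdet⟩ := hb.det_eq
      have hN0 : N.eval (z j) = 0 := by simp [hNW, h0]
      have hN1 : (derivative N).eval (z j) = 0 := by simp [hNW, h0, h1]
      have h2 := congrArg (fun p => (derivative p).eval (z j)) hdet
      have h3 : (derivative (C c * ∏ i ∈ Finset.range m, (X - C (z i)))).eval (z j) ≠ 0 := by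
        rw [derivative_C_mul, eval_mul, eval_C, ← Finset.mul_prod_erase _ _ (Finset.mem_range.2 hj)]
        simp only [derivative_mul, eval_add, eval_mul, eval_sub, eval_X, eval_C, sub_self, zero_mul,
          add_zero, derivative_sub, derivative_X, derivative_C, sub_zero, one_mul]
        refine mul_ne_zero hc ?_
        rw [eval_prod, Finset.prod_ne_zero_iff]
        intro i hi
        rw [Finset.mem_erase] at hi
        simp only [eval_sub, eval_X, eval_C]
        exact sub_ne_zero.2 fun h => hi.1 (hz (by simpa using hi.2) (by simpa using hj) h.symm)
      apply h3
      rw [← h2]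
      cases x <;> simp [← hN, ← hW, h0, h1, hN0, hN1]
    rw [div_eq_iff hW1, hNW]
    simp [h0]
  · have h1 := hb.discrepancy_eq x j hj
    rw [discrepancy, ← hN, ← hW, hNW, eval_mul, ← sub_mul] at h1
    rcases mul_eq_zero.1 h1 with h | h
    · linarith
    · exact absurd h h0

end RationalInterpolation

/-! ### Decoding of the code with a Vandermonde parity check matrix -/

section ErrorCorrection

open Polynomial

/-- The derivative at the `i`-th point of the polynomial with simple zeros at the first `m`. -/
def nodeWeight (m : ℕ) (z : ℕ → ℝ) (i : ℕ) : ℝ := ∏ l ∈ (Finset.range m).erase i, (z i - z l)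

theorem nodeWeight_ne_zero {m : ℕ} {z : ℕ → ℝ} (hz : Set.InjOn z (Finset.range m)) {i : ℕ}
    (hi : i < m) : nodeWeight m z i ≠ 0 := by
  refine Finset.prod_ne_zero_iff.2 fun l hl => sub_ne_zero.2 fun h => ?_
  rw [Finset.mem_erase] at hl
  exact hl.1 (hz (by simpa using hl.2) (by simpa using hi) h.symm)

/-- Vectors in the null space of a Vandermonde matrix are scaled vectors of values of polynomials of
small degree. -/
theorem exists_polynomial_of_sum_pow_mul_eq_zero {m k q : ℕ} (hm : q + k = m) {z c : ℕ → ℝ}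
    (hz : Set.InjOn z (Finset.range m))
    (hc : ∀ a < k, ∑ i ∈ Finset.range m, z i ^ a * c i = 0) :
    ∃ g : ℝ[X], g.degree < q ∧ ∀ i < m, g.eval (z i) = nodeWeight m z i * c i := by
  set g := Lagrange.interpolate (Finset.range m) z fun i => nodeWeight m z i * c i with hgdef
  have hval : ∀ i < m, g.eval (z i) = nodeWeight m z i * c i := fun i hi =>
    Lagrange.eval_interpolate_at_node _ hz (Finset.mem_range.2 hi)
  refine ⟨g, ?_, hval⟩
  by_contra! hq
  have hg0 : g ≠ 0 := by
    rintro h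
    simp [h] at hq
  have hlt : g.degree < m := by
    rw [hgdef]
    exact (Lagrange.degree_interpolate_lt _ hz).trans_eq (by simp)
  rw [degree_eq_natDegree hg0] at hq hlt
  have hq' : q ≤ g.natDegree := by exact_mod_cast hq
  have hlt' : g.natDegree < m := by exact_mod_cast hlt
  -- If deg g ≥ q, then b = m - 1 - deg g is less than k. The coefficient of g X^b at m - 1 is the
  -- leading coefficient of g; by Lagrange's formula it equals the b-th moment ∑ z_i^b c_i, which is
  -- zero.
  obtain ⟨b, hb⟩ : ∃ b, m = g.natDegree + b + 1 := ⟨m - g.natDegree - 1, by omega⟩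
  have hX : (g * X ^ b).degree < ((Finset.range m).card : WithBot ℕ) := by
    rw [degree_mul, degree_X_pow, degree_eq_natDegree hg0, Finset.card_range]
    exact_mod_cast (by omega : g.natDegree + b < m)
  have h1 := Lagrange.coeff_eq_sum hz hX
  rw [Finset.card_range, show m - 1 = g.natDegree + b by omega,
    coeff_mul_X_pow] at h1
  refine leadingCoeff_ne_zero.2 hg0 ?_
  rw [leadingCoeff, h1, ← hc b (by omega)]
  refine Finset.sum_congr rfl fun i hi => ?_
  have hi' := Finset.mem_range.1 hi
  have hw := nodeWeight_ne_zero hz hi'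
  rw [eval_mul, hval i hi', eval_pow, eval_X]
  change _ / nodeWeight m z i = _
  rw [div_eq_iff hw]
  ring

/-- The codeword near `r`. -/
def correctErrors (m q : ℕ) (z r : ℕ → ℝ) (j : ℕ) : ℝ :=
  ratioValue (lowerPair (interpState q z (fun i => nodeWeight m z i * r i) m)) (z j)
    (nodeWeight m z j * r j) / nodeWeight m z j

/-- Scaling by the nonzero node weights turns codewords into polynomial values without creating new
errors; dividing at the end undoes it. -/
theorem correctErrors_eq {m q τ : ℕ} (hm : q + 2 * τ = m) {z r c : ℕ → ℝ}
    (hz : Set.InjOn z (Finset.range m))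
    (hc : ∀ a < 2 * τ, ∑ i ∈ Finset.range m, z i ^ a * c i = 0)
    (hr : ((Finset.range m).filter fun i => r i ≠ c i).card ≤ τ) {j : ℕ} (hj : j < m) :
    correctErrors m q z r j = c j := by
  obtain ⟨g, hg, hv⟩ := exists_polynomial_of_sum_pow_mul_eq_zero hm hz hc
  rw [correctErrors, ratioValue_interpState hm hz hg ?_ hj, hv j hj,
    mul_div_cancel_left₀ _ (nodeWeight_ne_zero hz hj)]
  refine (Finset.card_le_card fun i hi => ?_).trans hr
  simp only [Finset.mem_filter, Finset.mem_range] at hi ⊢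
  refine ⟨hi.1, fun h => hi.2 ?_⟩
  rw [hv i hi.1, h]

end ErrorCorrection

/-! ### The cost of decoding -/

section DecodingCost

open Polynomial

variable {P ι Ω : Type} {φ : Ω → P → ℝ → ℝ → ℝ} {x : Ω → ι → ℝ} {B : Set (Ω → ℝ)} {m : ℕ}
  {z ρ r : ℕ → Ω → ℝ} {s : Ω → InterpState}

theorem derives_nodeWeight (h1 : (fun _ => 1) ∈ B) (hz : ∀ j < m, z j ∈ B) {i : ℕ} (hi : i < m) :
    Derives φ x B {fun ω => nodeWeight m (fun j => z j ω) i} (2 * m) := by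
  have hc : ((Finset.range m).erase i).card ≤ m :=
    (Finset.card_erase_le).trans_eq (Finset.card_range m)
  refine ((Derives.image ((Finset.range m).erase i) (fun l ω => z i ω - z l ω) (k := 1)
    fun l hl => Derives.sub (hz i hi) (hz l ?_)).comp
    (Derives.prod _ (fun l ω => z i ω - z l ω) (Or.inl h1) fun l hl => Or.inr ⟨l, hl, rfl⟩)).mono
    subset_rfl subset_rfl (by omega)
  exact Finset.mem_range.1 (Finset.mem_of_mem_erase hl)

/-- The registers that represent a state: the degree bounds, and the values and derivatives of all
polynomials at the points. -/
def stateRegs (m : ℕ) (z : ℕ → Ω → ℝ) (s : Ω → InterpState) : Set (Ω → ℝ) :=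
  (⋃ y ∈ (Finset.univ : Finset Bool), {fun ω => ((s ω y).2 : ℝ)}) ∪
    ⋃ p ∈ (Finset.univ : Finset (Bool × Bool)) ×ˢ Finset.range m,
      ({fun ω => ((s ω p.1.1).1 p.1.2).eval (z p.2 ω)} ∪
        {fun ω => (derivative ((s ω p.1.1).1 p.1.2)).eval (z p.2 ω)})

theorem degree_mem_stateRegs (y : Bool) : (fun ω => ((s ω y).2 : ℝ)) ∈ stateRegs m z s := by
  refine Or.inl ?_
  simp only [Set.mem_iUnion]
  exact ⟨y, Finset.mem_univ _, rfl⟩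

theorem eval_mem_stateRegs (y e : Bool) {j : ℕ} (hj : j < m) :
    (fun ω => ((s ω y).1 e).eval (z j ω)) ∈ stateRegs m z s := by
  refine Or.inr ?_
  simp only [Set.mem_iUnion]
  exact ⟨((y, e), j), by simpa using hj, Or.inl rfl⟩

theorem eval_derivative_mem_stateRegs (y e : Bool) {j : ℕ} (hj : j < m) :
    (fun ω => (derivative ((s ω y).1 e)).eval (z j ω)) ∈ stateRegs m z s := by
  refine Or.inr ?_
  simp only [Set.mem_iUnion]
  exact ⟨((y, e), j), by simpa using hj, Or.inr rfl⟩

theorem derives_stateRegs {k₁ k₂ : ℕ} (h₁ : ∀ y, Derives φ x B {fun ω => ((s ω y).2 : ℝ)} k₁)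
    (h₂ : ∀ y e, ∀ j < m, Derives φ x B {fun ω => ((s ω y).1 e).eval (z j ω)} k₂)
    (h₃ : ∀ y e, ∀ j < m, Derives φ x B {fun ω => (derivative ((s ω y).1 e)).eval (z j ω)} k₂) :
    Derives φ x B (stateRegs m z s) (2 * k₁ + 8 * m * k₂) := by
  refine ((Derives.biUnion _ _ fun y _ => h₁ y).union (Derives.biUnion _ _ fun p hp =>
    (h₂ p.1.1 p.1.2 p.2 ?_).union (h₃ p.1.1 p.1.2 p.2 ?_))).mono subset_rfl subset_rfl ?_
  · simpa using hp
  · simpa using hp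
  · simp only [Finset.card_product, Finset.card_univ, Fintype.card_prod, Fintype.card_bool,
      Finset.card_range]
    exact le_of_eq (by ring)

/-- The constant q is produced by adding ones. All initial values and derivatives are 0 or 1 and
cost nothing. -/
theorem derives_initState (h0 : (fun _ => 0) ∈ B) (h1 : (fun _ => 1) ∈ B) (q : ℕ) :
    Derives φ x B (stateRegs m z fun _ => initState q) (2 * q + 1) := by
  have hq : ∀ y, Derives φ x B {fun ω => ((initState q y).2 : ℝ)} q := by
    rintro (_ | _)
    · exact (Derives.of_subset (by simpa [initState] using h1)).mono subset_rfl subset_rfl (by omega)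
    · refine (Derives.sum (Finset.range q) (fun _ _ => 1) h0 fun _ _ => h1).mono subset_rfl ?_
        (by simp)
      simp [initState]
  refine (derives_stateRegs (k₂ := 0) hq (fun y e j _ => Derives.of_subset ?_)
    fun y e j _ => Derives.of_subset ?_).mono subset_rfl subset_rfl (by omega)
  · cases y <;> cases e <;> simpa [initState]
  · cases y <;> cases e <;> simpa [initState]

theorem derives_discrepancy {i : ℕ} (hi : i < m) (hρ : ρ i ∈ B) (hs : stateRegs m z s ⊆ B)
    (y : Bool) :
    Derives φ x B {fun ω => discrepancy (z i ω) (ρ i ω) (s ω y).1} 2 :=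
  (Derives.mul hρ (hs (eval_mem_stateRegs y true hi))).comp_singleton
    (Derives.sub (Or.inr (hs (eval_mem_stateRegs y false hi))) (Or.inl rfl))

-- Two discrepancies at cost 2 each, a degree comparison at cost 3 and two nested tests for zero at
-- cost 6 each.
open Classical in
theorem derives_hasPivot {i : ℕ} (hi : i < m) (h0 : (fun _ => 0) ∈ B) (h1 : (fun _ => 1) ∈ B)
    (hρ : ρ i ∈ B) (hs : stateRegs m z s ⊆ B) :
    Derives φ x B {fun ω => if HasPivot (z i ω) (ρ i ω) (s ω) then (1 : ℝ) else 0} 19 := by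
  have hd := (derives_discrepancy (φ := φ) (x := x) hi hρ hs false).union
    (derives_discrepancy hi hρ hs true)
  have h3 : Derives φ x B {fun ω => if ((s ω false).2 : ℝ) ≤ ((s ω true).2 : ℝ) then 1 else 0} 3 :=
    Derives.ite_le (hs (degree_mem_stateRegs _)) (hs (degree_mem_stateRegs _)) h1 h0
  refine ((hd.union h3).comp ((Derives.ite_eq_zero
    (f := fun ω => discrepancy (z i ω) (ρ i ω) (s ω true).1) (u := fun _ => 1)
    (v := fun ω => if ((s ω false).2 : ℝ) ≤ ((s ω true).2 : ℝ) then 1 else 0)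
    (Or.inl h0) (by simp) (Or.inl h1) (by simp)).comp_singleton (Derives.ite_eq_zero
    (f := fun ω => discrepancy (z i ω) (ρ i ω) (s ω false).1) (u := fun _ => 0)
    (Or.inr (Or.inl h0)) (by simp) (Or.inr (Or.inl h0)) (Or.inl rfl)))).mono subset_rfl ?_ le_rfl
  rw [Set.singleton_subset_iff, Set.mem_singleton_iff]
  funext ω
  by_cases ha : discrepancy (z i ω) (ρ i ω) (s ω false).1 = 0
  · simp [HasPivot, ha]
  · by_cases hb : discrepancy (z i ω) (ρ i ω) (s ω true).1 = 0 <;> simp [HasPivot, ha, hb]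

theorem derives_orient {i : ℕ} (hi : i < m) (h0 : (fun _ => 0) ∈ B) (h1 : (fun _ => 1) ∈ B)
    (hρ : ρ i ∈ B) (hs : stateRegs m z s ⊆ B) :
    Derives φ x B (stateRegs m z fun ω => orient (z i ω) (ρ i ω) (s ω)) (25 + 24 * m) := by
  classical
  refine ((derives_hasPivot hi h0 h1 hρ hs).comp (derives_stateRegs (k₁ := 3) (k₂ := 3)
    (fun y => ?_) (fun y e j hj => ?_) fun y e j hj => ?_)).mono subset_rfl subset_rfl (by omega)
  · refine (Derives.ite (Or.inl h1) (Or.inr rfl) (Or.inl (hs (degree_mem_stateRegs y)))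
      (Or.inl (hs (degree_mem_stateRegs !y)))).mono subset_rfl ?_ le_rfl
    rw [Set.singleton_subset_iff, Set.mem_singleton_iff]
    funext ω
    simp only [orient]
    split_ifs <;> rfl
  · refine (Derives.ite (Or.inl h1) (Or.inr rfl) (Or.inl (hs (eval_mem_stateRegs y e hj)))
      (Or.inl (hs (eval_mem_stateRegs (!y) e hj)))).mono subset_rfl ?_ le_rfl
    rw [Set.singleton_subset_iff, Set.mem_singleton_iff]
    funext ω
    simp only [orient]
    split_ifs <;> rfl
  · refine (Derives.ite (Or.inl h1) (Or.inr rfl) (Or.inl (hs (eval_derivative_mem_stateRegs y e hj)))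
      (Or.inl (hs (eval_derivative_mem_stateRegs (!y) e hj)))).mono subset_rfl ?_ le_rfl
    rw [Set.singleton_subset_iff, Set.mem_singleton_iff]
    funext ω
    simp only [orient]
    split_ifs <;> rfl

/-- New values and derivatives at z_j depend only on the old ones at z_j and on two discrepancies
shared by all j. At most 3 operations are needed for each; the product rule ((X - ζ)f)' = f + (X -
ζ)f' is one such case. -/
theorem derives_eliminate {i : ℕ} (hi : i < m) (h1 : (fun _ => 1) ∈ B) (hz : ∀ j < m, z j ∈ B)
    (hρ : ρ i ∈ B) (hs : stateRegs m z s ⊆ B) :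
    Derives φ x B (stateRegs m z fun ω => eliminate (z i ω) (ρ i ω) (s ω)) (6 + 24 * m) := by
  have hd := (derives_discrepancy (φ := φ) (x := x) hi hρ hs false).union
    (derives_discrepancy hi hρ hs true)
  refine (hd.comp (derives_stateRegs (k₁ := 1) (k₂ := 3)
    (fun y => ?_) (fun y e j hj => ?_) fun y e j hj => ?_)).mono subset_rfl subset_rfl (by omega)
  · cases y
    · refine (Derives.add (Or.inl (hs (degree_mem_stateRegs false))) (Or.inl h1)).mono subset_rfl ?_
        le_rfl
      simp [eliminate]
    · exact (Derives.of_subset (Set.singleton_subset_iff.2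
        (Or.inl (hs (degree_mem_stateRegs true))))).mono subset_rfl subset_rfl (by omega)
  · cases y
    · refine ((Derives.sub (Or.inl (hz j hj)) (Or.inl (hz i hi))).comp_singleton
        (Derives.mul (Or.inl rfl) (Or.inr (Or.inl (hs (eval_mem_stateRegs false e hj)))))).mono
        subset_rfl ?_ (by omega)
      simp [eliminate]
    · refine (((Derives.mul (Or.inr (Or.inl rfl))
        (Or.inl (hs (eval_mem_stateRegs true e hj)))).union (Derives.mul (Or.inr (Or.inr rfl))
        (Or.inl (hs (eval_mem_stateRegs false e hj))))).comp
        (Derives.sub (Or.inr (Or.inl rfl)) (Or.inr (Or.inr rfl)))).mono subset_rfl ?_ le_rfl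
      simp [eliminate]
  · cases y
    · refine (((Derives.sub (Or.inl (hz j hj)) (Or.inl (hz i hi))).comp_singleton
        (Derives.mul (Or.inl rfl)
          (Or.inr (Or.inl (hs (eval_derivative_mem_stateRegs false e hj)))))).comp_singleton
        (Derives.add (Or.inr (Or.inl (hs (eval_mem_stateRegs false e hj)))) (Or.inl rfl))).mono
        subset_rfl ?_ (by omega)
      simp [eliminate]
    · refine (((Derives.mul (Or.inr (Or.inl rfl))
        (Or.inl (hs (eval_derivative_mem_stateRegs true e hj)))).union
        (Derives.mul (Or.inr (Or.inr rfl))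
        (Or.inl (hs (eval_derivative_mem_stateRegs false e hj))))).comp
        (Derives.sub (Or.inr (Or.inl rfl)) (Or.inr (Or.inr rfl)))).mono subset_rfl ?_ le_rfl
      simp [eliminate]

theorem derives_interpState (h0 : (fun _ => 0) ∈ B) (h1 : (fun _ => 1) ∈ B)
    (hz : ∀ j < m, z j ∈ B) (hρ : ∀ j < m, ρ j ∈ B) (q : ℕ) :
    Derives φ x B (stateRegs m z fun ω => interpState q (fun j => z j ω) (fun j => ρ j ω) m)
      (2 * q + 1 + m * (31 + 48 * m)) := by
  refine (derives_initState h0 h1 q).comp (Derives.iterate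
    (fun i => stateRegs m z fun ω => interpState q (fun j => z j ω) (fun j => ρ j ω) i) m ?_)
  intro i hi
  refine ((derives_orient hi (Or.inl h0) (Or.inl h1) (Or.inl (hρ i hi))
    Set.subset_union_right).comp (derives_eliminate hi (Or.inl (Or.inl h1))
    (fun j hj => Or.inl (Or.inl (hz j hj))) (Or.inl (Or.inl (hρ i hi)))
    Set.subset_union_right)).mono subset_rfl subset_rfl (by omega)

theorem derives_ratioValue (h0 : (fun _ => 0) ∈ B) (hρ : ∀ j < m, ρ j ∈ B)
    (hs : stateRegs m z s ⊆ B) {j : ℕ} (hj : j < m) :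
    Derives φ x B {fun ω => ratioValue (lowerPair (s ω)) (z j ω) (ρ j ω)} 16 := by
  classical
  have hval : ∀ e, Derives φ x B {fun ω => (lowerPair (s ω) e).eval (z j ω)} 3 := fun e => by
    refine (Derives.ite_le (hs (degree_mem_stateRegs false)) (hs (degree_mem_stateRegs true))
      (hs (eval_mem_stateRegs false e hj)) (hs (eval_mem_stateRegs true e hj))).mono subset_rfl ?_
      le_rfl
    rw [Set.singleton_subset_iff, Set.mem_singleton_iff]
    funext ω
    simp only [lowerPair, Nat.cast_le]
    split_ifs <;> rfl
  have hder : ∀ e, Derives φ x B {fun ω => (derivative (lowerPair (s ω) e)).eval (z j ω)} 3 :=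
    fun e => by
    refine (Derives.ite_le (hs (degree_mem_stateRegs false)) (hs (degree_mem_stateRegs true))
      (hs (eval_derivative_mem_stateRegs false e hj))
      (hs (eval_derivative_mem_stateRegs true e hj))).mono subset_rfl ?_ le_rfl
    rw [Set.singleton_subset_iff, Set.mem_singleton_iff]
    funext ω
    simp only [lowerPair, Nat.cast_le]
    split_ifs <;> rfl
  refine (((hval true).union (((hder false).union (hder true)).comp
    (Derives.div (Or.inr (Or.inl rfl)) (Or.inr (Or.inr rfl))))).comp
    (Derives.ite_eq_zero (Or.inl h0) (Or.inr (Or.inl rfl)) (Or.inr (Or.inr rfl))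
      (Or.inl (hρ j hj)))).mono subset_rfl subset_rfl le_rfl

theorem derives_correctErrors (h0 : (fun _ => 0) ∈ B) (h1 : (fun _ => 1) ∈ B)
    (hz : ∀ j < m, z j ∈ B) (hr : ∀ j < m, r j ∈ B) {q : ℕ} (hq : q ≤ m) :
    Derives φ x B ((fun j ω => correctErrors m q (fun j => z j ω) (fun j => r j ω) j) ''
      (Finset.range m)) (105 * m ^ 2) := by
  -- The bound has no constant term, so m = 0 is separate; for m ≥ 1 lower-order terms are absorbed
  -- into m².
  rcases Nat.eq_zero_or_pos m with rfl | hm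
  · exact (Derives.of_subset (by simp)).mono subset_rfl subset_rfl (by simp)
  set w : ℕ → Ω → ℝ := fun j ω => nodeWeight m (fun j => z j ω) j
  set ρ : ℕ → Ω → ℝ := fun j ω => nodeWeight m (fun j => z j ω) j * r j ω
  have hw : Derives φ x B (w '' (Finset.range m)) (m * (2 * m)) :=
    (Derives.image _ w fun j hj => derives_nodeWeight h1 hz (Finset.mem_range.1 hj)).mono subset_rfl
      subset_rfl (by simp)
  have hwρ : Derives φ x B (w '' (Finset.range m) ∪ ρ '' (Finset.range m)) (m * (2 * m) + m) :=
    hw.trans ((Derives.image _ ρ (k := 1) fun j hj => Derives.mul (Or.inr ⟨j, hj, rfl⟩)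
      (Or.inl (hr j (Finset.mem_range.1 hj)))).mono subset_rfl subset_rfl (by simp))
  have hρ : ∀ j < m, ρ j ∈ w '' (Finset.range m) ∪ ρ '' (Finset.range m) := fun j hj =>
    Or.inr ⟨j, by simpa using hj, rfl⟩
  have hw' : ∀ j ∈ Finset.range m, w j ∈ w '' (Finset.range m) ∪ ρ '' (Finset.range m) :=
    fun j hj => Or.inl ⟨j, hj, rfl⟩
  have hst := hwρ.trans (derives_interpState (q := q) (Or.inl h0) (Or.inl h1)
    (fun j hj => Or.inl (hz j hj)) (fun j hj => Or.inr (hρ j hj)))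
  have hfin := hst.comp (Derives.image (k := 17) (Finset.range m)
    (fun j ω => correctErrors m q (fun j => z j ω) (fun j => r j ω) j) fun j hj =>
    (derives_ratioValue (ρ := ρ) (Or.inl h0) (fun j hj => Or.inr (Or.inl (hρ j hj)))
      (fun _ h => Or.inr (Or.inr h)) (Finset.mem_range.1 hj)).comp_singleton
    (Derives.div (f := fun ω => ratioValue (lowerPair
      (interpState q (fun j => z j ω) (fun j => ρ j ω) m)) (z j ω) (ρ j ω)) (g := w j)
      (Or.inl rfl) (Or.inr (Or.inr (Or.inl (hw' j hj))))))
  refine hfin.mono subset_rfl subset_rfl ?_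
  rw [Finset.card_range]
  nlinarith

end DecodingCost

/-! ### The encoding matrices -/

section Encoding

/-- A finite sequence, continued with zeros. -/
def extendZero {m : ℕ} (v : Fin m → ℝ) (i : ℕ) : ℝ := if h : i < m then v ⟨i, h⟩ else 0

@[simp] theorem extendZero_val {m : ℕ} (v : Fin m → ℝ) (i : Fin m) : extendZero v i = v i := by
  simp [extendZero]

theorem injOn_extendZero {m : ℕ} {z : Fin m → ℝ} (hz : Function.Injective z) :
    Set.InjOn (extendZero z) (Finset.range m) := by
  intro i hi j hj h
  have hi' : i < m := by simpa using hi
  have hj' : j < m := by simpa using hj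
  simp only [extendZero, hi', hj', dif_pos] at h
  exact congrArg Fin.val (hz h)

/-- The negative of the value at the point `k + j` of the `i`-th Lagrange basis polynomial at the
first `k` points. -/
def parityEntry (k : ℕ) (z : ℕ → ℝ) (i j : ℕ) : ℝ :=
  0 - ∏ l ∈ (Finset.range k).erase i, (z (k + j) - z l) / (z i - z l)

/-- Lagrange interpolation at k nodes reproduces X^a for a < k; evaluate at the node k + j. -/
theorem sum_pow_mul_parityEntry {k : ℕ} {z : ℕ → ℝ} (hz : Set.InjOn z (Finset.range k)) {a : ℕ}
    (ha : a < k) (j : ℕ) :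
    ∑ i ∈ Finset.range k, z i ^ a * parityEntry k z i j = -z (k + j) ^ a := by
  have h := Lagrange.eq_interpolate (f := (Polynomial.X : Polynomial ℝ) ^ a) hz
    (by rw [Polynomial.degree_X_pow, Finset.card_range]; exact_mod_cast ha)
  have h' := congrArg (Polynomial.eval (z (k + j))) h
  rw [Lagrange.interpolate_apply, Polynomial.eval_finsetSum, Polynomial.eval_pow,
    Polynomial.eval_X] at h'
  rw [h', ← Finset.sum_neg_distrib]
  refine Finset.sum_congr rfl fun i _ => ?_
  simp only [parityEntry, Lagrange.basis, Lagrange.basisDivisor, Polynomial.eval_mul,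
    Polynomial.eval_prod, Polynomial.eval_C, Polynomial.eval_sub, Polynomial.eval_X,
    Polynomial.eval_pow, zero_sub, mul_neg, div_eq_inv_mul]

/-- The basis of the null space of the error-locator matrix that is the identity in the last
rows. -/
def codeBasis (k q m : ℕ) (z : ℕ → ℝ) : Matrix (Fin m) (Fin q) ℝ := Matrix.of fun i j =>
  if (i : ℕ) < k then parityEntry k z i j else if (i : ℕ) = k + j then 1 else 0

theorem mem_ker_errorLocator {m k : ℕ} {z : Fin m → ℝ} {c : Fin m → ℝ} :
    c ∈ LinearMap.ker (errorLocator k z).mulVecLin ↔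
      ∀ a < k, ∑ i ∈ Finset.range m, extendZero z i ^ a * extendZero c i = 0 := by
  simp only [LinearMap.mem_ker, Matrix.mulVecLin_apply, funext_iff, Matrix.mulVec, dotProduct,
    errorLocator, Matrix.of_apply, Pi.zero_apply, Finset.sum_range, extendZero_val]
  exact ⟨fun h a ha => h ⟨a, ha⟩, fun h a => h a a.2⟩

theorem codeBasis_mem_ker {m k q : ℕ} (hm : k + q = m) {z : Fin m → ℝ}
    (hz : Function.Injective z) (j : Fin q) :
    (fun i => codeBasis k q m (extendZero z) i j) ∈ LinearMap.ker (errorLocator k z).mulVecLin := by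
  subst hm
  rw [mem_ker_errorLocator]
  intro a ha
  have hz' : Set.InjOn (extendZero z) (Finset.range k) :=
    (injOn_extendZero hz).mono (by simp [Set.subset_def]; omega)
  rw [Finset.sum_range_add, Finset.sum_congr rfl (g := fun i =>
    extendZero z i ^ a * parityEntry k (extendZero z) i j), sum_pow_mul_parityEntry hz' ha,
    Finset.sum_eq_single (j : ℕ)]
  · simp [extendZero, codeBasis]
  · intro i hi hij
    have hi' := Finset.mem_range.1 hi
    simp [extendZero, codeBasis, hi', hij]
  · simp
  · intro i hi
    have hi' := Finset.mem_range.1 hi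
    refine congrArg _ ?_
    rw [extendZero, dif_pos (by omega)]
    simp [codeBasis, hi']

/-- The polynomial of degree < q attached to the null vector vanishes at the q last nodes, so it is
zero. -/
theorem eq_zero_of_mem_ker_errorLocator {m k q : ℕ} (hm : k + q = m) {z : Fin m → ℝ}
    (hz : Function.Injective z) {c : Fin m → ℝ}
    (hc : c ∈ LinearMap.ker (errorLocator k z).mulVecLin) (h0 : ∀ i : Fin m, k ≤ i → c i = 0) :
    c = 0 := by
  have hz' := injOn_extendZero hz
  obtain ⟨g, hg, hv⟩ := exists_polynomial_of_sum_pow_mul_eq_zero (q := q) (by omega) hz'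
    (mem_ker_errorLocator.1 hc)
  have : g = 0 := by
    refine Polynomial.eq_zero_of_degree_lt_of_eval_index_eq_zero (v := extendZero z)
      (s := Finset.Ico k m) (hz'.mono (by simp [Set.subset_def])) ?_ ?_
    · rw [Nat.card_Ico, ← hm, Nat.add_sub_cancel_left]
      exact hg
    · intro i hi
      rw [Finset.mem_Ico] at hi
      rw [hv i hi.2, extendZero, dif_pos hi.2, h0 _ hi.1, mul_zero]
  funext i
  have h := hv i i.2
  rw [this, Polynomial.eval_zero, extendZero_val] at h
  exact (mul_eq_zero.1 h.symm).resolve_left (nodeWeight_ne_zero hz' i.2)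

theorem isSparseNullBasis_codeBasis {m k q : ℕ} (hm : k + q = m) {z : Fin m → ℝ}
    (hz : Function.Injective z) :
    IsSparseNullBasis (errorLocator k z) (codeBasis k q m (extendZero z)) := by
  have hlast : ∀ (i : Fin m) (j : Fin q), k ≤ (i : ℕ) →
      codeBasis k q m (extendZero z) i j = if (i : ℕ) = k + (j : ℕ) then 1 else 0 := by
    intro i j hi
    simp [codeBasis, not_lt.2 hi]
  have hcomb : ∀ (u : Fin q → ℝ) (j : Fin q),
      (∑ l, u l • fun i => codeBasis k q m (extendZero z) i l) ⟨k + j, by omega⟩ = u j := by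
    intro u j
    rw [Finset.sum_apply, Finset.sum_eq_single j]
    · simp [codeBasis]
    · intro l _ hl
      have : (j : ℕ) ≠ l := fun h => hl (Fin.ext h.symm)
      simp [codeBasis, this]
    · simp
  refine ⟨?_, le_antisymm ?_ ?_, hlast⟩
  · rw [Fintype.linearIndependent_iff]
    intro u hu j
    rw [← hcomb u j, hu, Pi.zero_apply]
  · rw [Submodule.span_le]
    rintro _ ⟨j, rfl⟩
    exact codeBasis_mem_ker hm hz j
  -- Subtracting the combination with the last q coordinates of `c` as coefficients leaves a null
  -- vector that vanishes in the last q rows.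
  · intro c hc
    have h := eq_zero_of_mem_ker_errorLocator hm hz
      (c := c - ∑ l : Fin q, c ⟨k + l, by omega⟩ • fun i => codeBasis k q m (extendZero z) i l)
      (Submodule.sub_mem _ hc (Submodule.sum_mem _ fun l _ =>
        Submodule.smul_mem _ _ (codeBasis_mem_ker hm hz l))) ?_
    · rw [sub_eq_zero] at h
      rw [h]
      exact Submodule.sum_mem _ fun l _ => Submodule.smul_mem _ _ (Submodule.subset_span ⟨l, rfl⟩)
    · intro i hi
      have := hcomb (fun l => c ⟨k + l, by omega⟩) ⟨i - k, by omega⟩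
      have hi' : (⟨k + ((⟨i - k, by omega⟩ : Fin q) : ℕ), by simp; omega⟩ : Fin m) = i :=
        Fin.ext (by simp; omega)
      rw [hi'] at this
      rw [Pi.sub_apply, this, sub_self]

theorem extendZero_eq_sum {N : ℕ} (v : Fin N → ℝ) (i : ℕ) :
    extendZero v i = ∑ c : Fin N, if (c : ℕ) = i then v c else 0 := by
  by_cases h : i < N
  · rw [Finset.sum_eq_single ⟨i, h⟩]
    · simp [extendZero, h]
    · intro c _ hc
      exact if_neg fun h' => hc (Fin.ext h')
    · simp
  · rw [extendZero, dif_neg h, Finset.sum_eq_zero]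
    intro c _
    exact if_neg (by omega)

theorem encodingMatrix_mulVec {m q p N : ℕ} (B : Matrix (Fin m) (Fin q) ℝ) (i : Fin m)
    (v : Fin N → ℝ) (a : Fin p) :
    (encodingMatrix B p N i *ᵥ v) a = ∑ j : Fin q, B i j * extendZero v (a * q + j) := by
  simp only [extendZero_eq_sum, Finset.mul_sum]
  rw [Finset.sum_comm]
  simp only [Matrix.mulVec, dotProduct]
  refine Finset.sum_congr rfl fun c _ => ?_
  simp only [encodingMatrix, Matrix.of_apply]
  split_ifs with h
  · rw [Finset.sum_eq_single ⟨c - a * q, by omega⟩]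
    · rw [if_pos (by simp only; omega)]
    · intro j _ hj
      rw [if_neg, mul_zero]
      intro h'
      exact hj (Fin.ext (by simp only; omega))
    · simp
  · rw [zero_mul, Finset.sum_eq_zero]
    intro j _
    rw [if_neg (by omega), mul_zero]

/-- The entry of a product with an encoding matrix, for the rows that have to be computed. -/
theorem encodingMatrix_codeBasis_mulVec_of_lt {m k q p N : ℕ} (z : ℕ → ℝ) {i : Fin m}
    (hi : (i : ℕ) < k) (v : Fin N → ℝ) (a : Fin p) :
    (encodingMatrix (codeBasis k q m z) p N i *ᵥ v) a =
      ∑ j : Fin q, parityEntry k z i j * extendZero v (a * q + j) := by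
  rw [encodingMatrix_mulVec]
  simp [codeBasis, hi]

/-- These rows are unit vectors, so the product only copies an entry of `v`. This makes them free to
encode and lets the master read off decoded data. -/
theorem encodingMatrix_codeBasis_mulVec_of_le {m k q p N : ℕ} (hm : k + q = m) (z : ℕ → ℝ)
    {i : Fin m} (hi : k ≤ (i : ℕ)) (v : Fin N → ℝ) (a : Fin p) :
    (encodingMatrix (codeBasis k q m z) p N i *ᵥ v) a = extendZero v (a * q + (i - k)) := by
  rw [encodingMatrix_mulVec, Finset.sum_eq_single ⟨i - k, by omega⟩]
  · simp [codeBasis, not_lt.2 hi, Nat.add_sub_cancel' hi]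
  · intro j _ hj
    have : (i : ℕ) ≠ k + j := fun h => hj (Fin.ext (by simp only; omega))
    simp [codeBasis, not_lt.2 hi, this]
  · simp

/-- The reals of the `a`-th block of the replies. -/
def replyBlock {m p : ℕ} (r : Fin m ⊕ Fin m × Fin p → ℝ) (a i : ℕ) : ℝ :=
  if h : i < m ∧ a < p then r (Sum.inr (⟨i, h.1⟩, ⟨a, h.2⟩)) else 0

/-- A vector is recovered from its encoded blocks in spite of corrupt and missing replies. -/
theorem correctErrors_replyBlock {m q p N s t : ℕ} (hm : 2 * (s + t) + q = m)
    (hp : N ≤ p * q) {z : Fin m → ℝ} (hz : Function.Injective z) (v : Fin N → ℝ)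
    {r : Fin m → Option (Fin p → ℝ)}
    (hr : Received s t (fun i =>
      encodingMatrix (codeBasis (2 * (s + t)) q m (extendZero z)) p N i *ᵥ v) r) (l : Fin N) :
    correctErrors m q (extendZero z) (replyBlock (replyInput r) (l / q))
      (2 * (s + t) + l % q) = v l := by
  have hq : 0 < q := by
    have := l.2
    rcases Nat.eq_zero_or_pos q with rfl | h
    · omega
    · exact h
  have hlq := Nat.mod_lt (l : ℕ) hq
  have ha : (l : ℕ) / q < p := by
    rw [Nat.div_lt_iff_lt_mul hq]
    exact l.2.trans_le hp
  set a : Fin p := ⟨l / q, ha⟩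
  set S := encodingMatrix (codeBasis (2 * (s + t)) q m (extendZero z)) p N with hS
  -- For a fixed block, the replies as a function of the worker are a combination of the columns of
  -- the basis.
  have hker : (fun i => (S i *ᵥ v) a) ∈
      LinearMap.ker (errorLocator (2 * (s + t)) z).mulVecLin := by
    have : (fun i => (S i *ᵥ v) a) = ∑ j : Fin q, extendZero v (a * q + j) •
        fun i => codeBasis (2 * (s + t)) q m (extendZero z) i j := by
      funext i
      rw [hS, encodingMatrix_mulVec, Finset.sum_apply]
      exact Finset.sum_congr rfl fun j _ => mul_comm _ _
    rw [this]
    exact Submodule.sum_mem _ fun j _ => Submodule.smul_mem _ _ (codeBasis_mem_ker hm hz j)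
  obtain ⟨I, J, hI, hJ, -, hIJ⟩ := hr
  rw [correctErrors_eq (τ := s + t) (c := extendZero fun i => (S i *ᵥ v) a) (by omega)
    (injOn_extendZero hz) (mem_ker_errorLocator.1 hker) ?_ (by omega)]
  · rw [extendZero, dif_pos (by omega), hS, encodingMatrix_codeBasis_mulVec_of_le hm _ (by simp),
      show (a : ℕ) * q + (2 * (s + t) + l % q - 2 * (s + t)) = l by
        rw [Nat.add_sub_cancel_left]; exact Nat.div_add_mod' _ _, extendZero_val]
  -- Corrupt and straggling workers are both treated as errors: wrong coordinates lie in I ∪ J, of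
  -- size at most s + t.
  · refine (Finset.card_le_card (t := (I ∪ J).map Fin.valEmbedding) fun i hi => ?_).trans ?_
    · rw [Finset.mem_filter, Finset.mem_range] at hi
      simp only [Finset.mem_map, Finset.mem_union, Fin.valEmbedding_apply]
      refine ⟨⟨i, hi.1⟩, ?_, rfl⟩
      by_contra! h
      refine hi.2 ?_
      simp [replyBlock, hi.1, ha, replyInput, hIJ _ h.1 h.2, extendZero, hS, a]
    · rw [Finset.card_map]
      exact (Finset.card_union_le _ _).trans (by omega)

end Encoding

/-! ### The programs of the scheme -/

section SchemePrograms

variable {P ι Ω : Type} {φ : Ω → P → ℝ → ℝ → ℝ} {x : Ω → ι → ℝ} {B : Set (Ω → ℝ)} {m k q : ℕ}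

theorem extendZero_mem {v : Ω → Fin m → ℝ} (h0 : (fun _ => 0) ∈ B)
    (hv : ∀ i, (fun ω => v ω i) ∈ B) (j : ℕ) : (fun ω => extendZero (v ω) j) ∈ B := by
  by_cases hj : j < m
  · simpa [extendZero, hj] using hv ⟨j, hj⟩
  · simpa [extendZero, hj] using h0

theorem derives_parityEntry {z : ℕ → Ω → ℝ} (h0 : (fun _ => 0) ∈ B) (h1 : (fun _ => 1) ∈ B)
    (hz : ∀ j, z j ∈ B) (i j : ℕ) :
    Derives φ x B {fun ω => parityEntry k (fun l => z l ω) i j} (4 * k + 1) := by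
  have hc : ((Finset.range k).erase i).card ≤ k :=
    (Finset.card_erase_le).trans_eq (Finset.card_range k)
  refine (((Derives.image ((Finset.range k).erase i)
    (fun l ω => (z (k + j) ω - z l ω) / (z i ω - z l ω)) (k := 3) fun l _ =>
    ((Derives.sub (hz (k + j)) (hz l)).union (Derives.sub (hz i) (hz l))).comp
      (Derives.div (Or.inr (Or.inl rfl)) (Or.inr (Or.inr rfl)))).comp
    (Derives.prod _ (fun l ω => (z (k + j) ω - z l ω) / (z i ω - z l ω)) (Or.inl h1)
      fun l hl => Or.inr ⟨l, hl, rfl⟩)).comp_singleton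
    (Derives.sub (Or.inr h0) (Or.inl rfl))).mono subset_rfl subset_rfl (by omega)

/-- Only the k workers with nontrivial rows cost anything, one inner product of length q for each
entry; this yields the factor k in place of m in the encoding time. -/
theorem derives_encodingMatrix_mul {N M p : ℕ} (hm : k + q = m) {z : Ω → ℕ → ℝ}
    {V : Ω → Matrix (Fin N) (Fin M) ℝ} (h0 : (fun _ => 0) ∈ B)
    (hV : ∀ a c, (fun ω => V ω a c) ∈ B)
    (hz : ∀ i < k, ∀ j < q, (fun ω => parityEntry k (z ω) i j) ∈ B) :
    Derives φ x B (Set.range fun (e : Fin m × Fin p × Fin M) ω =>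
      (encodingMatrix (codeBasis k q m (z ω)) p N e.1 * V ω) e.2.1 e.2.2)
      (k * p * M * (q * 2)) := by
  have hmem : ∀ (c : Fin M) (l : ℕ), (fun ω => extendZero (fun a => V ω a c) l) ∈ B :=
    fun c => extendZero_mem h0 fun a => hV a c
  have hmul : ∀ (e : Fin m × Fin p × Fin M) ω,
      (encodingMatrix (codeBasis k q m (z ω)) p N e.1 * V ω) e.2.1 e.2.2 =
      (encodingMatrix (codeBasis k q m (z ω)) p N e.1 *ᵥ fun a => V ω a e.2.2) e.2.1 :=
    fun e ω => rfl
  set s : Finset (Fin m × Fin p × Fin M) :=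
    (Finset.univ.filter fun i : Fin m => (i : ℕ) < k) ×ˢ Finset.univ with hs
  have hcard : s.card = k * p * M := by
    rw [hs, Finset.card_product, Fin.card_filter_val_lt, Finset.card_univ, Fintype.card_prod,
      Fintype.card_fin, Fintype.card_fin, mul_assoc, Nat.min_eq_right (by omega)]
  have h1 := Derives.image (φ := φ) (x := x) (B := B) (k := q * 2) s
    (fun e ω => (encodingMatrix (codeBasis k q m (z ω)) p N e.1 * V ω) e.2.1 e.2.2) ?_
  -- The vacuous first derivation keeps `B` in the result, which supplies the entries of the unit
  -- rows.
  · refine ((Derives.of_subset subset_rfl).trans (h1.mono Set.subset_union_left subset_rfl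
      le_rfl)).mono subset_rfl ?_ (by rw [hcard, zero_add])
    rintro _ ⟨e, rfl⟩
    by_cases he : (e.1 : ℕ) < k
    · exact Or.inr ⟨e, by simpa [hs] using he, rfl⟩
    · refine Or.inl ?_
      simp only [hmul, encodingMatrix_codeBasis_mulVec_of_le hm _ (not_lt.1 he)]
      exact hmem _ _
  · intro e he
    have he' : (e.1 : ℕ) < k := by simpa [hs] using he
    simp only [hmul, encodingMatrix_codeBasis_mulVec_of_lt _ he']
    refine (Derives.sum_mul (Finset.univ : Finset (Fin q)) _ _ h0 (fun j _ => hz _ he' j j.2)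
      fun j _ => hmem e.2.2 (e.2.1 * q + j)).mono subset_rfl subset_rfl (by simp)

theorem exists_encode (hm : k + q = m) (n d p₁ p₂ : ℕ) :
    ∃ T : Prog Empty (Fin m ⊕ Fin n × Fin d) (Fin m × (Fin p₁ × Fin d ⊕ Fin p₂ × Fin n)),
      T.cost ≤ 1 + k * q * (4 * k + 1) + k * p₁ * d * (q * 2) + k * p₂ * n * (q * 2) ∧
      ∀ (z : Fin m → ℝ) (X : Matrix (Fin n) (Fin d) ℝ) (i : Fin m),
        (∀ a c, T.evalArith (Sum.elim z fun e => X e.1 e.2) (i, Sum.inl (a, c)) =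
          (encodingMatrix (codeBasis k q m (extendZero z)) p₁ n i * X) a c) ∧
        ∀ a c, T.evalArith (Sum.elim z fun e => X e.1 e.2) (i, Sum.inr (a, c)) =
          (encodingMatrix (codeBasis k q m (extendZero z)) p₂ d i * Xᵀ) a c := by
  let Ω := Fin m ⊕ Fin n × Fin d → ℝ
  let z : Ω → ℕ → ℝ := fun ω => extendZero fun i => ω (Sum.inl i)
  let V : Ω → Matrix (Fin n) (Fin d) ℝ := fun ω => Matrix.of fun a c => ω (Sum.inr (a, c))
  let φ : Ω → Empty → ℝ → ℝ → ℝ := fun _ f => f.elim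
  let x : Ω → (Fin m ⊕ Fin n × Fin d) → ℝ := fun ω => ω
  have h0 : (fun _ => 0) ∈ baseRegs x := Or.inl rfl
  have hz : ∀ j, (fun ω => z ω j) ∈ baseRegs x := extendZero_mem h0 fun i => Or.inr ⟨_, rfl⟩
  have hV : ∀ a c, (fun ω => V ω a c) ∈ baseRegs x := fun a c => Or.inr ⟨_, rfl⟩
  set A := (fun (e : ℕ × ℕ) ω => parityEntry k (z ω) e.1 e.2) ''
    (Finset.range k ×ˢ Finset.range q : Finset (ℕ × ℕ)) with hA
  have h1 : Derives φ x (baseRegs x) A (1 + k * q * (4 * k + 1)) :=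
    Derives.one.comp ((Derives.image _ _ fun e _ => derives_parityEntry (Or.inl h0) (Or.inr rfl)
      (fun j => Or.inl (hz j)) _ _).mono subset_rfl subset_rfl (by simp))
  have hpar : ∀ i < k, ∀ j < q, (fun ω => parityEntry k (z ω) i j) ∈ A := fun i hi j hj =>
    ⟨(i, j), by simp [hi, hj], rfl⟩
  have h2 := h1.comp ((derives_encodingMatrix_mul (p := p₁) hm (V := V) (Or.inl h0)
    (fun a c => Or.inl (hV a c)) fun i hi j hj => Or.inr (hpar i hi j hj)).union
    (derives_encodingMatrix_mul (p := p₂) hm (V := fun ω => (V ω)ᵀ) (Or.inl h0)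
    (fun a c => Or.inl (hV c a)) fun i hi j hj => Or.inr (hpar i hi j hj)))
  obtain ⟨T, hT, hT'⟩ := h2.exists_prog (κ := Fin m × (Fin p₁ × Fin d ⊕ Fin p₂ × Fin n))
    (fun e ω => Sum.elim (fun b => (encodingMatrix (codeBasis k q m (z ω)) p₁ n e.1 * V ω) b.1 b.2)
      (fun b => (encodingMatrix (codeBasis k q m (z ω)) p₂ d e.1 * (V ω)ᵀ) b.1 b.2) e.2) (by
    rintro ⟨i, b | b⟩
    · exact Or.inr (Or.inl ⟨(i, b), rfl⟩)
    · exact Or.inr (Or.inr ⟨(i, b), rfl⟩))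
  refine ⟨T, hT.trans (by omega), fun z X i => ⟨fun a c => ?_, fun a c => ?_⟩⟩
  · exact hT' (Sum.elim z fun e => X e.1 e.2) (i, Sum.inl (a, c))
  · exact hT' (Sum.elim z fun e => X e.1 e.2) (i, Sum.inr (a, c))

theorem exists_worker (p d : ℕ) :
    ∃ T : Prog Empty (Fin p × Fin d ⊕ Fin d) (Fin p), T.cost ≤ p * (d * 2) ∧
      ∀ (A : Matrix (Fin p) (Fin d) ℝ) (w : Fin d → ℝ),
        T.evalArith (Sum.elim (fun e => A e.1 e.2) w) = A *ᵥ w := by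
  let Ω := Fin p × Fin d ⊕ Fin d → ℝ
  let φ : Ω → Empty → ℝ → ℝ → ℝ := fun _ f => f.elim
  let x : Ω → (Fin p × Fin d ⊕ Fin d) → ℝ := fun ω => ω
  have h := Derives.image (φ := φ) (x := x) (B := baseRegs x) (k := d * 2) Finset.univ
    (fun (a : Fin p) ω => ∑ c : Fin d, ω (Sum.inl (a, c)) * ω (Sum.inr c)) fun a _ =>
      (Derives.sum_mul Finset.univ _ _ (Or.inl rfl) (fun c _ => Or.inr ⟨_, rfl⟩)
        fun c _ => Or.inr ⟨_, rfl⟩).mono subset_rfl subset_rfl (by simp)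
  obtain ⟨T, hT, hT'⟩ := h.exists_prog (κ := Fin p) _ fun a => Or.inr ⟨a, by simp, rfl⟩
  refine ⟨T, by simpa using hT, fun A w => funext fun a => ?_⟩
  exact hT' (Sum.elim (fun e => A e.1 e.2) w) a

/-- Each of the p blocks is decoded once and all its entries are read from that result, so the cost
scales with p and not with N. -/
theorem derives_correctErrors_replyBlock {p N : ℕ} {z : Ω → Fin m → ℝ}
    {r : Ω → Fin m ⊕ Fin m × Fin p → ℝ} (h0 : (fun _ => 0) ∈ B)
    (hz : ∀ i, (fun ω => z ω i) ∈ B) (hr : ∀ e, (fun ω => r ω e) ∈ B) (hq : k + q = m)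
    (hp : N ≤ p * q) :
    Derives φ x B (Set.range fun (l : Fin N) ω => correctErrors m q (extendZero (z ω))
      (replyBlock (r ω) (l / q)) (k + l % q)) (1 + p * (105 * m ^ 2)) := by
  have hrb : ∀ a j, (fun ω => replyBlock (r ω) a j) ∈ B := by
    intro a j
    by_cases h : j < m ∧ a < p
    · simpa [replyBlock, h] using hr (Sum.inr (⟨j, h.1⟩, ⟨a, h.2⟩))
    · simpa [replyBlock, h] using h0
  refine (Derives.one.comp (Derives.biUnion (Finset.range p) _ fun a _ =>
    derives_correctErrors (z := fun j ω => extendZero (z ω) j)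
      (r := fun j ω => replyBlock (r ω) a j) (Or.inl h0) (Or.inr rfl)
      (fun j _ => Or.inl (extendZero_mem h0 hz j)) (fun j _ => Or.inl (hrb a j))
      (by omega : q ≤ m))).mono subset_rfl ?_ (by simp)
  rintro _ ⟨l, rfl⟩
  have hq0 : 0 < q := by
    have := l.2
    rcases Nat.eq_zero_or_pos q with rfl | h
    · omega
    · exact h
  simp only [Set.mem_iUnion]
  refine ⟨l / q, ?_, k + l % q, ?_, rfl⟩
  · rw [Finset.mem_range, Nat.div_lt_iff_lt_mul hq0]
    exact l.2.trans_le hp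
  · have := Nat.mod_lt (l : ℕ) hq0
    simp only [Finset.coe_range, Set.mem_Iio]
    omega

theorem exists_master₁ {n p : ℕ} (hm : k + q = m) (hp : n ≤ p * q) :
    ∃ T : Prog Unit (Fin m ⊕ Fin n ⊕ (Fin m ⊕ Fin m × Fin p)) (Fin n),
      T.cost ≤ 1 + p * (105 * m ^ 2) + n ∧
      ∀ (ℓ : ℝ → ℝ → ℝ) (z : Fin m → ℝ) (y : Fin n → ℝ) (r : Fin m ⊕ Fin m × Fin p → ℝ) (l : Fin n),
        T.eval (fun _ => ℓ) (Sum.elim z (Sum.elim y r)) l =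
          ℓ (correctErrors m q (extendZero z) (replyBlock r (l / q)) (k + l % q)) (y l) := by
  -- The interpretation of the primitive is part of ω, so one program works for all losses.
  let Ω := (ℝ → ℝ → ℝ) × (Fin m ⊕ Fin n ⊕ (Fin m ⊕ Fin m × Fin p) → ℝ)
  let φ : Ω → Unit → ℝ → ℝ → ℝ := fun ω _ => ω.1
  let x : Ω → (Fin m ⊕ Fin n ⊕ (Fin m ⊕ Fin m × Fin p)) → ℝ := fun ω => ω.2
  let f : Fin n → Ω → ℝ := fun l ω => correctErrors m q (extendZero fun i => ω.2 (Sum.inl i))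
    (replyBlock (fun e => ω.2 (Sum.inr (Sum.inr e))) (l / q)) (k + l % q)
  have h1 : Derives φ x (baseRegs x) (Set.range f) (1 + p * (105 * m ^ 2)) :=
    derives_correctErrors_replyBlock (Or.inl rfl) (fun i => Or.inr ⟨_, rfl⟩)
      (fun e => Or.inr ⟨_, rfl⟩) hm hp
  have h2 := h1.comp (Derives.image (k := 1) Finset.univ
    (fun (l : Fin n) ω => φ ω () (f l ω) (ω.2 (Sum.inr (Sum.inl l)))) fun l _ =>
    Derives.prim () (Or.inr ⟨l, rfl⟩) (Or.inl (Or.inr ⟨_, rfl⟩)))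
  obtain ⟨T, hT, hT'⟩ := h2.exists_prog (κ := Fin n) _ fun l => Or.inr ⟨l, by simp, rfl⟩
  refine ⟨T, by simpa using hT, fun ℓ z y r l => ?_⟩
  exact hT' (ℓ, Sum.elim z (Sum.elim y r)) l

theorem exists_master₂ (n : ℕ) {d p : ℕ} (hm : k + q = m) (hp : d ≤ p * q) :
    ∃ T : Prog Empty (Fin m ⊕ (Fin m ⊕ Fin m × Fin p)) (Fin d),
      T.cost ≤ 1 + p * (105 * m ^ 2) + n + d + 2 ∧
      ∀ (z : Fin m → ℝ) (r : Fin m ⊕ Fin m × Fin p → ℝ) (l : Fin d),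
        T.evalArith (Sum.elim z r) l = 1 / (n : ℝ) *
          correctErrors m q (extendZero z) (replyBlock r (l / q)) (k + l % q) := by
  let Ω := Fin m ⊕ (Fin m ⊕ Fin m × Fin p) → ℝ
  let φ : Ω → Empty → ℝ → ℝ → ℝ := fun _ f => f.elim
  let x : Ω → (Fin m ⊕ (Fin m ⊕ Fin m × Fin p)) → ℝ := fun ω => ω
  let f : Fin d → Ω → ℝ := fun l ω => correctErrors m q (extendZero fun i => ω (Sum.inl i))
    (replyBlock (fun e => ω (Sum.inr e)) (l / q)) (k + l % q)
  have h0 : (fun _ => 0) ∈ baseRegs x := Or.inl rfl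
  have h1 : Derives φ x (baseRegs x) (Set.range f) (1 + p * (105 * m ^ 2)) :=
    derives_correctErrors_replyBlock h0 (fun i => Or.inr ⟨_, rfl⟩) (fun e => Or.inr ⟨_, rfl⟩) hm hp
  -- The number n is a sum of ones; for n = 0 the quotient is 0 on both sides.
  have h2 : Derives φ x (baseRegs x) {fun _ => 1 / (n : ℝ)} (1 + (n + 1)) := by
    refine Derives.one.comp (((Derives.sum (Finset.range n) (fun _ _ => 1) (Or.inl h0)
      fun _ _ => Or.inr rfl).comp_singleton (Derives.div (Or.inr (Or.inr rfl))
      (Or.inl rfl))).mono subset_rfl ?_ (by simp))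
    simp
  have h3 := (h1.union h2).comp (Derives.image (k := 1) Finset.univ
    (fun (l : Fin d) ω => 1 / (n : ℝ) * f l ω) fun l _ =>
    Derives.mul (Or.inr (Or.inr rfl)) (Or.inr (Or.inl ⟨l, rfl⟩)))
  obtain ⟨T, hT, hT'⟩ := h3.exists_prog (κ := Fin d) _ fun l => Or.inr ⟨l, by simp, rfl⟩
  refine ⟨T, hT.trans (by simp; omega), fun z r l => ?_⟩
  exact hT' (Sum.elim z r) l

/-- The gradient of the empirical risk. -/
theorem hasGradientAt_empiricalRisk {n d : ℕ} {ℓ : ℝ → ℝ → ℝ} (X : Matrix (Fin n) (Fin d) ℝ)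
    {y : Fin n → ℝ} (hℓ : ∀ i, Differentiable ℝ fun u => ℓ u (y i))
    (w : EuclideanSpace ℝ (Fin d)) :
    HasGradientAt (empiricalRisk ℓ X y)
      (WithLp.toLp 2 fun l => 1 / (n : ℝ) * (Xᵀ *ᵥ lossDerivVec ℓ X y w) l) w := by
  let L : Fin n → EuclideanSpace ℝ (Fin d) →L[ℝ] ℝ := fun i =>
    innerSL ℝ (WithLp.toLp 2 (X i) : EuclideanSpace ℝ (Fin d))
  have hL : ∀ i v, L i v = (X *ᵥ v.ofLp) i := by
    intro i v
    simp [L, Matrix.mulVec, PiLp.inner_apply, dotProduct, mul_comm]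
  have h : HasFDerivAt (empiricalRisk ℓ X y)
      ((1 / (n : ℝ)) • ∑ i, lossDerivVec ℓ X y w i • L i) w := by
    refine HasFDerivAt.const_mul (HasFDerivAt.fun_sum fun i _ => ?_) _
    have h1 : HasDerivAt (fun u => ℓ u (y i)) (lossDerivVec ℓ X y w i) (L i w) := by
      rw [hL]
      exact (hℓ i _).hasDerivAt
    have h2 := h1.comp_hasFDerivAt w (L i).hasFDerivAt
    simpa only [Function.comp_def, hL] using h2
  rw [hasGradientAt_iff_hasFDerivAt]
  refine h.congr_fderiv (ContinuousLinearMap.ext fun v => ?_)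
  simp only [InnerProductSpace.toDual_apply_apply, PiLp.inner_apply, smul_apply, sum_apply, hL, Matrix.mulVec, dotProduct, Matrix.transpose_apply,
    RCLike.inner_apply, conj_trivial, smul_eq_mul, Finset.mul_sum]
  rw [Finset.sum_comm]
  refine Finset.sum_congr rfl fun i _ => Finset.sum_congr rfl fun c _ => ?_
  ring

end SchemePrograms

/-! ### The scheme -/

section CodedScheme

/-! ### Rounding in the number of blocks -/

theorem le_ceilDiv_mul (n : ℕ) {q : ℕ} (hq : 0 < q) : n ≤ n ⌈/⌉ q * q := by
  have := (ceilDiv_le_iff_le_mul hq).1 (le_refl (n ⌈/⌉ q))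
  rwa [mul_comm] at this

theorem ceilDiv_mul_le (n : ℕ) {q : ℕ} (hq : 0 < q) : n ⌈/⌉ q * q ≤ n + q := by
  rw [Nat.ceilDiv_eq_add_pred_div]
  exact (Nat.div_mul_le_self _ _).trans (by omega)

theorem ceilDiv_mul_eq {n q : ℕ} (hq : 0 < q) (h : q ∣ n) : n ⌈/⌉ q * q = n := by
  obtain ⟨a, rfl⟩ := h
  refine le_antisymm ?_ (le_ceilDiv_mul _ hq)
  rw [mul_comm]
  exact Nat.mul_le_mul_left _ ((ceilDiv_le_iff_le_mul hq).2 le_rfl)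

/-- The scheme that corrects errors and erasures with a code of redundancy `2 (s + t)`. -/
theorem exists_codedScheme {m s t q : ℕ} (n d : ℕ) (hm : 2 * (s + t) + q = m) (hq : 0 < q) :
    ∃ S : Scheme m n d,
      (∀ z : Fin m → ℝ, Function.Injective z →
        S.IsCodedBy z (codeBasis (2 * (s + t)) q m (extendZero z)) ∧ S.ComputesGradient s t z) ∧
      S.p₁ = n ⌈/⌉ q ∧ S.p₂ = d ⌈/⌉ q ∧
      S.workerCost ≤ n ⌈/⌉ q * (d * 2) + d ⌈/⌉ q * (n * 2) ∧
      S.masterCost ≤ (n ⌈/⌉ q + d ⌈/⌉ q) * (105 * m ^ 2) + 2 * n + d + 4 ∧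
      S.encode.cost ≤ 1 + 2 * (s + t) * q * (4 * (2 * (s + t)) + 1)
        + 2 * (s + t) * (n ⌈/⌉ q) * d * (q * 2) + 2 * (s + t) * (d ⌈/⌉ q) * n * (q * 2) := by
  have hn := le_ceilDiv_mul n hq
  have hd := le_ceilDiv_mul d hq
  obtain ⟨E, hE, hE'⟩ := exists_encode hm n d (n ⌈/⌉ q) (d ⌈/⌉ q)
  obtain ⟨W₁, hW₁, hW₁'⟩ := exists_worker (n ⌈/⌉ q) d
  obtain ⟨W₂, hW₂, hW₂'⟩ := exists_worker (d ⌈/⌉ q) n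
  obtain ⟨M₁, hM₁, hM₁'⟩ := exists_master₁ hm hn
  obtain ⟨M₂, hM₂, hM₂'⟩ := exists_master₂ n hm hd
  have hcoded : ∀ z, Scheme.IsCodedBy ⟨_, _, E, W₁, M₁, W₂, M₂⟩ z
      (codeBasis (2 * (s + t)) q m (extendZero z)) := fun z =>
    ⟨fun X i => Matrix.ext fun a c => (hE' z X i).1 a c,
      fun X i => Matrix.ext fun a c => (hE' z X i).2 a c, hW₁', hW₂'⟩
  refine ⟨⟨_, _, E, W₁, M₁, W₂, M₂⟩, fun z hz => ⟨hcoded z, ?_⟩, rfl, rfl,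
    add_le_add hW₁ hW₂, ?_, hE⟩
  · intro X y ℓ hℓ w r₁ hr₁
    obtain ⟨hs₁, hs₂, hr₁', hr₂'⟩ := hcoded z
    -- By associativity the replies (S_i X) w are the encodings S_i (X w) of the single vector X w,
    -- to which decoding applies.
    simp only [hr₁', hs₁, ← Matrix.mulVec_mulVec] at hr₁
    have h₁ : Scheme.decode₁ ⟨_, _, E, W₁, M₁, W₂, M₂⟩ ℓ z y r₁ = lossDerivVec ℓ X y w := by
      funext l
      rw [Scheme.decode₁, hM₁', correctErrors_replyBlock hm hn hz _ hr₁, lossDerivVec]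
    refine ⟨h₁, fun r₂ hr₂ => ?_⟩
    rw [h₁] at hr₂
    simp only [hr₂', hs₂, ← Matrix.mulVec_mulVec] at hr₂
    have h₂ : Scheme.decode₂ ⟨_, _, E, W₁, M₁, W₂, M₂⟩ z r₂ =
        fun l => 1 / (n : ℝ) * (Xᵀ *ᵥ lossDerivVec ℓ X y w) l := by
      funext l
      rw [Scheme.decode₂, hM₂', correctErrors_replyBlock hm hd hz _ hr₂]
    rw [h₂]
    exact hasGradientAt_empiricalRisk X hℓ w
  · refine (add_le_add hM₁ hM₂).trans ?_
    rw [add_mul]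
    omega

/-- Rounding up costs at most one block, so p ≤ n/q + 1, and m/q ≤ 1 + ε. -/
theorem ceilDiv_mul_workers_le {n m q : ℕ} {ε : ℝ} (hq : 0 < q)
    (hmq : (m : ℝ) ≤ (1 + ε) * q) : ((n ⌈/⌉ q : ℕ) : ℝ) * m ≤ (1 + ε) * n + m := by
  have hq' : (0 : ℝ) < q := by exact_mod_cast hq
  have h1 : ((n ⌈/⌉ q : ℕ) : ℝ) * q ≤ n + q := by exact_mod_cast ceilDiv_mul_le n hq
  have h2 : ((n ⌈/⌉ q : ℕ) : ℝ) ≤ n / q + 1 := by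
    rw [div_add_one hq'.ne', le_div_iff₀ hq']
    exact h1
  have h3 : (n : ℝ) / q * m ≤ (1 + ε) * n := by
    rw [div_mul_eq_mul_div, div_le_iff₀ hq']
    have := mul_le_mul_of_nonneg_left hmq (Nat.cast_nonneg (α := ℝ) n)
    linarith
  have := mul_le_mul_of_nonneg_right h2 (Nat.cast_nonneg (α := ℝ) m)
  linarith

theorem ceilDiv_mul_workers_le_of_dvd {n m q : ℕ} {ε : ℝ} (hq : 0 < q)
    (hmq : (m : ℝ) ≤ (1 + ε) * q) (h : q ∣ n) :
    ((n ⌈/⌉ q : ℕ) : ℝ) * m ≤ (1 + ε) * n := by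
  have h1 : ((n ⌈/⌉ q : ℕ) : ℝ) * q = n := by exact_mod_cast ceilDiv_mul_eq hq h
  rw [← h1]
  have := mul_le_mul_of_nonneg_left hmq (Nat.cast_nonneg (α := ℝ) (n ⌈/⌉ q))
  linarith

theorem ceilDiv_le_ceil {n m q : ℕ} {ε : ℝ} (hm : 0 < m) (hq : 0 < q)
    (hmq : (m : ℝ) ≤ (1 + ε) * q) : n ⌈/⌉ q ≤ ⌈(1 + ε) * n / m⌉₊ := by
  have hm' : (0 : ℝ) < m := by exact_mod_cast hm
  rw [ceilDiv_le_iff_le_mul hq]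
  have h1 := mul_le_mul_of_nonneg_left (Nat.le_ceil ((1 + ε) * n / m)) (Nat.cast_nonneg (α := ℝ) q)
  have h2 : (n : ℝ) ≤ q * ((1 + ε) * n / m) := by
    rw [mul_div_assoc', le_div_iff₀ hm']
    have := mul_le_mul_of_nonneg_left hmq (Nat.cast_nonneg (α := ℝ) n)
    linarith
  exact_mod_cast h2.trans h1

end CodedScheme

end

/-! ### The theorem: choice of the constant and final estimates -/

theorem theorem1 :
    ∃ C : ℝ, 0 < C ∧ ∀ (m n d s t : ℕ) (ε : ℝ), 0 < m → 0 < ε →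
      s + t ≤ ⌊ε / (1 + ε) * ((m : ℝ) / 2)⌋₊ →
      ∃ S : Scheme m n d,
        -- the scheme is exact, with the stated encoding, for any evaluation points
        (∀ z : Fin m → ℝ, Function.Injective z → (∀ i, z i ≠ 0) →
          (∃ B : Matrix (Fin m) (Fin (m - 2 * (s + t))) ℝ,
            IsSparseNullBasis (errorLocator (2 * (s + t)) z) B ∧ S.IsCodedBy z B) ∧
          S.ComputesGradient s t z) ∧
        S.p₁ = n ⌈/⌉ (m - 2 * (s + t)) ∧ S.p₂ = d ⌈/⌉ (m - 2 * (s + t)) ∧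
        -- storage
        (S.storage : ℝ) ≤ 2 * (1 + ε) * (n * d) + m * (n + d) + n ∧
        (m - 2 * (s + t) ∣ n → m - 2 * (s + t) ∣ d →
          (S.storage : ℝ) ≤ 2 * (1 + ε) * (n * d) + n) ∧
        -- communication
        S.workerSends ≤ ⌈(1 + ε) * n / m⌉₊ + ⌈(1 + ε) * d / m⌉₊ ∧
        (m - 2 * (s + t) ∣ n → m - 2 * (s + t) ∣ d →
          (S.workerSends : ℝ) ≤ (1 + ε) * ((n + d) / m)) ∧
        S.masterBroadcasts = n + d ∧
        -- time, with at least as many data points and features as workers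
        (m ≤ n → m ≤ d →
          (S.workerCost : ℝ) ≤ C * ((1 + ε) * (n * d / m)) ∧
          (S.masterCost : ℝ) ≤ C * ((1 + ε) * (n + d) * m) ∧
          (S.encode.cost : ℝ) ≤ C * (n * d * (ε / (1 + ε) * m + 1))) := by
  -- The master dictates the constant: 105·2 from decoding, as p m ≤ 2(1+ε)n when m ≤ n and likewise
  -- for d, plus a few units for the linear terms. Workers need 8 and encoding 13.
  refine ⟨300, by norm_num, fun m n d s t ε hm hε hst => ?_⟩
  have hε1 : 0 < 1 + ε := by linarith
  have hm' : (1 : ℝ) ≤ m := by exact_mod_cast hm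
  have hk : ((2 * (s + t) : ℕ) : ℝ) ≤ ε / (1 + ε) * m := by
    have h1 : ((s + t : ℕ) : ℝ) ≤ ε / (1 + ε) * (m / 2) :=
      (Nat.cast_le.2 hst).trans (Nat.floor_le (by positivity))
    push_cast at h1 ⊢
    linarith
  -- Hence q = m - k ≥ m/(1+ε), which gives both q > 0 and m ≤ (1+ε)q.
  have hfrac : ε / (1 + ε) * m = m - m / (1 + ε) := by field_simp; ring
  have hfrac0 : 0 < m / (1 + ε) := by positivity
  have hkm : 2 * (s + t) < m := by
    have : ((2 * (s + t) : ℕ) : ℝ) < m := by linarith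
    exact_mod_cast this
  obtain ⟨q, hq⟩ : ∃ q, m - 2 * (s + t) = q := ⟨_, rfl⟩
  rw [hq]
  have hmq' : 2 * (s + t) + q = m := by omega
  have hq0 : 0 < q := by omega
  have hmq : (m : ℝ) ≤ (1 + ε) * q := by
    have h1 : ((2 * (s + t) : ℕ) : ℝ) + q = m := by exact_mod_cast hmq'
    have h2 : m / (1 + ε) ≤ q := by linarith
    rw [div_le_iff₀ hε1] at h2
    linarith
  obtain ⟨S, hS, hp₁, hp₂, hW, hM, hE⟩ := exists_codedScheme n d hmq' hq0
  have hstorage : (S.storage : ℝ) = (n ⌈/⌉ q : ℕ) * m * d + (d ⌈/⌉ q : ℕ) * m * n + n := by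
    simp only [Scheme.storage, Prog.numOut, Fintype.card_prod, Fintype.card_sum, Fintype.card_fin,
      hp₁, hp₂]
    push_cast
    ring
  have hsends : S.workerSends = n ⌈/⌉ q + d ⌈/⌉ q := by
    simp only [Scheme.workerSends, Prog.numOut, Fintype.card_fin, hp₁, hp₂]
  have hn0 : (0 : ℝ) ≤ n := Nat.cast_nonneg n
  have hd0 : (0 : ℝ) ≤ d := Nat.cast_nonneg d
  have hpn := ceilDiv_mul_workers_le (n := n) hq0 hmq
  have hpd := ceilDiv_mul_workers_le (n := d) hq0 hmq
  refine ⟨S, fun z hz _ => ⟨⟨_, isSparseNullBasis_codeBasis hmq' hz, (hS z hz).1⟩, (hS z hz).2⟩,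
    hp₁, hp₂, ?_, ?_, ?_, ?_, ?_, ?_⟩
  · rw [hstorage]
    linarith [mul_le_mul_of_nonneg_right hpn hd0, mul_le_mul_of_nonneg_right hpd hn0]
  · intro hqn hqd
    rw [hstorage]
    linarith [mul_le_mul_of_nonneg_right (ceilDiv_mul_workers_le_of_dvd hq0 hmq hqn) hd0,
      mul_le_mul_of_nonneg_right (ceilDiv_mul_workers_le_of_dvd hq0 hmq hqd) hn0]
  · rw [hsends]
    exact add_le_add (ceilDiv_le_ceil hm hq0 hmq) (ceilDiv_le_ceil hm hq0 hmq)
  · intro hqn hqd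
    rw [hsends, mul_div_assoc', le_div_iff₀ (by linarith)]
    push_cast
    linarith [ceilDiv_mul_workers_le_of_dvd hq0 hmq hqn, ceilDiv_mul_workers_le_of_dvd hq0 hmq hqd]
  · simp [Scheme.masterBroadcasts, Prog.numOut, add_comm]
  · intro hmn hmd
    have hmn' : (m : ℝ) ≤ n := by exact_mod_cast hmn
    have hmd' : (m : ℝ) ≤ d := by exact_mod_cast hmd
    have hpn' : ((n ⌈/⌉ q : ℕ) : ℝ) * m ≤ 2 * (1 + ε) * n := by
      have := mul_nonneg hε.le hn0
      linarith
    have hpd' : ((d ⌈/⌉ q : ℕ) : ℝ) * m ≤ 2 * (1 + ε) * d := by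
      have := mul_nonneg hε.le hd0
      linarith
    refine ⟨?_, ?_, ?_⟩
    · refine (Nat.cast_le.2 hW).trans ?_
      rw [mul_div_assoc', mul_div_assoc', le_div_iff₀ (by linarith)]
      push_cast
      have h1 := mul_le_mul_of_nonneg_right hpn' hd0
      have h2 := mul_le_mul_of_nonneg_right hpd' hn0
      have h3 : 0 ≤ (1 + ε) * (n * d) := by positivity
      linarith
    · refine (Nat.cast_le.2 hM).trans ?_
      push_cast
      have h1 := mul_le_mul_of_nonneg_right hpn' (zero_le_one.trans hm')
      have h2 := mul_le_mul_of_nonneg_right hpd' (zero_le_one.trans hm')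
      have h3 : (n + d : ℝ) ≤ (1 + ε) * (n + d) * m := by
        have h4 : (1 : ℝ) ≤ (1 + ε) * m := one_le_mul_of_one_le_of_one_le (by linarith) hm'
        have := mul_le_mul_of_nonneg_left h4 (add_nonneg hn0 hd0)
        linarith
      linarith
    · refine (Nat.cast_le.2 hE).trans ?_
      obtain ⟨k, hkd⟩ : ∃ k, 2 * (s + t) = k := ⟨_, rfl⟩
      rw [hkd] at hk hkm ⊢
      have hnd : m * m ≤ n * d := Nat.mul_le_mul hmn hmd
      -- Computing the k q parity entries is cubic in the number of workers; q ≤ m, 4k + 1 ≤ 5m and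
      -- m² ≤ nd absorb it.
      have h1 : k * q * (4 * k + 1) ≤ k * (n * d) * 5 := by
        have : q * (4 * k + 1) ≤ m * (m * 5) := Nat.mul_le_mul (by omega) (by omega)
        calc k * q * (4 * k + 1) = k * (q * (4 * k + 1)) := by ring
          _ ≤ k * (n * d * 5) := Nat.mul_le_mul_left _ (by linarith)
          _ = _ := by ring
      have h2 : k * (n ⌈/⌉ q) * d * (q * 2) ≤ k * (n * d) * 4 := by
        have := ceilDiv_mul_le n hq0
        calc k * (n ⌈/⌉ q) * d * (q * 2) = k * d * 2 * (n ⌈/⌉ q * q) := by ring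
          _ ≤ k * d * 2 * (2 * n) := Nat.mul_le_mul_left _ (by omega)
          _ = _ := by ring
      have h3 : k * (d ⌈/⌉ q) * n * (q * 2) ≤ k * (n * d) * 4 := by
        have := ceilDiv_mul_le d hq0
        calc k * (d ⌈/⌉ q) * n * (q * 2) = k * n * 2 * (d ⌈/⌉ q * q) := by ring
          _ ≤ k * n * 2 * (2 * d) := Nat.mul_le_mul_left _ (by omega)
          _ = _ := by ring
      have h4 : 1 ≤ n * d := (Nat.mul_pos hm hm).trans_le hnd
      have h5 : 1 + k * q * (4 * k + 1) + k * (n ⌈/⌉ q) * d * (q * 2)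
          + k * (d ⌈/⌉ q) * n * (q * 2) ≤ 13 * (n * d * (k + 1)) := by linarith
      refine (Nat.cast_le.2 h5).trans ?_
      push_cast
      have h6 : (0 : ℝ) ≤ n * d := by positivity
      have h7 : (n : ℝ) * d * (k + 1) ≤ n * d * (ε / (1 + ε) * m + 1) :=
        mul_le_mul_of_nonneg_left (by linarith) h6
      have h8 : (0 : ℝ) ≤ n * d * (k + 1) := by positivity
      linarith
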